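/- Let $k$ be a field. *Formulas* of (unit-free) multiplicative linear logic MLL are built from positive and negative atoms $X,\neg X$ by $\otimes$ and $\parr$; negation is the involution exchanging $X$ and $\neg X$ with $\neg(A\otimes B)=\neg B\parr\neg A$ and $\neg(A\parr B)=\neg B\otimes\neg A$. A *proof structure* consists of finitely many links and finitely many edges labelled by formulas, each edge being a conclusion of exactly one link and a premise of exactly one link; the links are axiom links (no premise, two conclusions labelled $A$ and $\neg A$), cut links (two premises labelled $A$ and $\neg A$, no conclusion), $\otimes$-links and $\parr$-links (premises labelled $A,B$ and conclusion labelled $A\otimes B$, respectively $A\parr B$) and conclusion links (one premise, no conclusion). A *proof net* is a proof structure that is the translation of a proof in the MLL sequent calculus (axiom, cut, $\otimes$ and $\parr$ rules, no mix rule). The *conclusions* of a proof structure are the formulas labelling the premises of its conclusion links. For a formula $A$ with $m$ occurrences of atoms let $\mathbb S(A)=\mathbb P_k^{2^m-1}$, with homogeneous coordinates indexed as follows: the coordinates of an atom are indexed by $\{0,1\}$, and those of $A\otimes B$ and of $A\parr B$ by pairs of an index for $A$ and an index for $B$. Thus there are Segre embeddings $\mathbb S(A)\times\mathbb S(B)\to\mathbb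 S(A\otimes B)$ and $\mathbb S(A)\times\mathbb S(B)\to\mathbb S(A\parr B)$. Identify $\mathbb S(\neg A)=\mathbb S(A)$ by matching dual occurrences of atoms, so that the coordinate $(a,b)$ of $A\otimes B$ (or of $A\parr B$) corresponds to the coordinate $(b,a)$ of its negation, recursively. Let $\zeta$ be a proof structure with set of edges $\mathcal E$, the edge $e$ being labelled by $A_e$, and put $\mathbb S(\zeta)=\prod_{e\in\mathcal E}\mathbb S(A_e)$, a product over $k$. For a link $l$ let $\mathbb X(l)$ be the following closed subscheme of the product of the $\mathbb S(A_e)$ over the edges $e$ incident to $l$: the diagonal of $\mathbb S(A)\times\mathbb S(\neg A)$ for axiom and cut links, the graph of the Segre embedding for $\otimes$- and $\parr$-links, and all of $\mathbb S(A)$ for conclusion links. Let $\iota_\zeta:\mathbb X(\zeta)\to\mathbb S(\zeta)$ be the scheme-theoretic intersection, over all links $l$, of the preimages of $\mathbb X(l)$ in $\mathbb S(\zeta)$. **Theorem.** Let $\zeta$ be an MLL proof net with conclusions $A_1,\dots,A_n$ (necessarily $n\ge1$), and let $\rho_{\mathrm{Conc}}:\mathbb S(\zeta)\to\prod_{i=1}^n\mathbb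 S(A_i)$ be the projection. Then the composite $$\mathbb X(\zeta)\xrightarrow{\ \iota_\zeta\ }\mathbb S(\zeta)\xrightarrow{\ \rho_{\mathrm{Conc}}\ }\prod_{i=1}^n\mathbb S(A_i)$$ is a closed immersion. Moreover, let $m_i$ be the number of occurrences of atoms in $A_i$, and let $$S=k[x_0,\dots,x_{2^{m_1}-1}]\times_k\cdots\times_k k[x_0,\dots,x_{2^{m_n}-1}]=\bigoplus_{d\ge0}\,\bigotimes_{i=1}^n k[x_0,\dots,x_{2^{m_i}-1}]_d$$ be the Cartesian product of the homogeneous coordinate rings of the $\mathbb S(A_i)$, a graded subring of their tensor product over $k$, together with the canonical morphism $\tau:\prod_i\mathbb S(A_i)\to\operatorname{Proj}S$. Then there is a unique homogeneous ideal $I\subseteq S$ that is saturated (that is, $x\,(S_+)^N\subseteq I$ for some $N$ implies $x\in I$) and satisfies $\operatorname{Proj}(S/I)\cong\mathbb X(\zeta)$ over $\operatorname{Proj}S$, where $\mathbb X(\zeta)\to\operatorname{Proj}S$ is $\tau\circ\rho_{\mathrm{Conc}}\circ\iota_\zeta$. For this ideal and every $d\ge0$, the $k$-module $(S/I)_d$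 is locally free of some finite rank. Here a module $M$ over a commutative ring $R$ is locally free of rank $r$ if there are $f_1,\dots,f_N\in R$ generating the unit ideal such that each $M_{f_j}$ is a free $R_{f_j}$-module of rank $r$. -/

import Mathlib

universe u v w

noncomputable section

namespace LL

open CategoryTheory Limits AlgebraicGeometry MvPolynomial HomogeneousLocalization

attribute [local instance] MvPolynomial.gradedAlgebra

section Charts
variable {k : Type u} [Field k] {A : Type u} [CommRing A] [Algebra k A]
  (𝒜 : ℕ → Submodule k A) [GradedAlgebra 𝒜]

/-- The map `x / f ^ n ↦ φ x / φ f ^ n` on the degree-zero part of `A_f`. -/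
def awayLift {R : Type u} [CommRing R] (f : A) (φ : A →+* R) (hu : IsUnit (φ f)) :
    Away 𝒜 f →+* R :=
  (IsLocalization.Away.lift (S := Localization.Away f) f hu).comp
    (algebraMap (Away 𝒜 f) (Localization.Away f))

lemma awayLift_mk_mul {R : Type u} [CommRing R] {f : A} {m : ℕ} (hf : f ∈ 𝒜 m) (φ : A →+* R)
    (hu : IsUnit (φ f)) (n : ℕ) (x : A) (hx : x ∈ 𝒜 (n • m)) :
    awayLift 𝒜 f φ hu (Away.mk 𝒜 hf n x hx) * φ f ^ n = φ x := by
  have h : algebraMap (Away 𝒜 f) (Localization.Away f) (Away.mk 𝒜 hf n x hx) *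
      algebraMap A (Localization.Away f) f ^ n = algebraMap A _ x := by
    rw [HomogeneousLocalization.algebraMap_apply, Away.val_mk, ← map_pow,
      Localization.mk_eq_mk']
    exact IsLocalization.mk'_spec _ x (⟨f ^ n, n, rfl⟩ : Submonoid.powers f)
  have := congrArg (IsLocalization.Away.lift (S := Localization.Away f) f hu) h
  simpa [awayLift] using this

lemma awayLift_eq {R : Type u} [CommRing R] {f : A} {m : ℕ} (hf : f ∈ 𝒜 m) (φ : A →+* R)
    (hu : IsUnit (φ f)) (χ : Away 𝒜 f →+* R)
    (h : ∀ (n : ℕ) (x : A) (hx : x ∈ 𝒜 (n • m)), χ (Away.mk 𝒜 hf n x hx) * φ f ^ n = φ x) :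
    χ = awayLift 𝒜 f φ hu := by
  ext z
  obtain ⟨n, x, hx, rfl⟩ := Away.mk_surjective 𝒜 hf z
  refine (hu.pow n).mul_right_cancel ?_
  rw [h, awayLift_mk_mul]

/-- The morphism to the open subscheme `f ≠ 0` of `Proj 𝒜` given on functions by
`x / f ^ n ↦ φ x / φ f ^ n`. -/
def chart {Y : Scheme.{u}} (φ : A →+* Γ(Y, ⊤)) (f : A) {m : ℕ} (hf : f ∈ 𝒜 m) (hm : 0 < m)
    (hu : IsUnit (φ f)) : Y ⟶ Proj 𝒜 :=
  Y.toSpecΓ ≫ Spec.map (CommRingCat.ofHom (awayLift 𝒜 f φ hu)) ≫ Proj.awayι 𝒜 f hf hm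

lemma comp_chart {Z Y : Scheme.{u}} (g : Z ⟶ Y) (φ : A →+* Γ(Y, ⊤)) (f : A) {m : ℕ}
    (hf : f ∈ 𝒜 m) (hm : 0 < m) (hu : IsUnit (φ f)) :
    g ≫ chart 𝒜 φ f hf hm hu = chart 𝒜 (g.appTop.hom.comp φ) f hf hm (hu.map g.appTop.hom) := by
  have : awayLift 𝒜 f (g.appTop.hom.comp φ) (hu.map g.appTop.hom) =
      g.appTop.hom.comp (awayLift 𝒜 f φ hu) := by
    refine (awayLift_eq 𝒜 hf _ _ _ fun n x hx ↦ ?_).symm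
    have := congrArg g.appTop.hom (awayLift_mk_mul 𝒜 hf φ hu n x hx)
    simpa using this
  rw [chart, chart, this, CommRingCat.ofHom_comp, Spec.map_comp, CommRingCat.ofHom_hom,
    Scheme.toSpecΓ_naturality_assoc, Category.assoc]

lemma chart_mul {Y : Scheme.{u}} (φ : A →+* Γ(Y, ⊤)) (f g : A) {m m' : ℕ} (hf : f ∈ 𝒜 m)
    (hm : 0 < m) (hu : IsUnit (φ f)) (hg : g ∈ 𝒜 m') (hu' : IsUnit (φ (f * g))) :
    chart 𝒜 φ (f * g) (SetLike.mul_mem_graded hf hg) (hm.trans_le (m.le_add_right m')) hu' =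
      chart 𝒜 φ f hf hm hu := by
  have : awayLift 𝒜 f φ hu = (awayLift 𝒜 (f * g) φ hu').comp (awayMap 𝒜 hg rfl) := by
    refine (awayLift_eq 𝒜 hf _ _ _ fun n x hx ↦ ?_).symm
    have hgu : IsUnit (φ g) := isUnit_of_mul_isUnit_right (by simpa using hu')
    refine (hgu.pow n).mul_right_cancel ?_
    rw [mul_assoc, ← mul_pow, ← map_mul, RingHom.comp_apply, awayMap_mk]
    rw [awayLift_mk_mul]
    simp
  rw [chart, chart, this, CommRingCat.ofHom_comp, Spec.map_comp, Category.assoc,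
    Proj.SpecMap_awayMap_awayι]

lemma chart_scale {Y : Scheme.{u}} (φ ψ : A →+* Γ(Y, ⊤)) (u : Γ(Y, ⊤))
    (h : ∀ d, ∀ x ∈ 𝒜 d, ψ x = u ^ d * φ x) (f : A) {m : ℕ} (hf : f ∈ 𝒜 m)
    (hm : 0 < m) (hu : IsUnit (φ f)) (hu' : IsUnit (ψ f)) :
    chart 𝒜 φ f hf hm hu = chart 𝒜 ψ f hf hm hu' := by
  have : awayLift 𝒜 f φ hu = awayLift 𝒜 f ψ hu' := by
    refine awayLift_eq 𝒜 hf _ _ _ fun n x hx ↦ ?_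
    rw [h m f hf, h _ x hx, mul_pow, ← awayLift_mk_mul 𝒜 hf φ hu n x hx, smul_eq_mul]
    ring
  rw [chart, chart, this]

lemma chart_eq {Y : Scheme.{u}} (φ ψ : A →+* Γ(Y, ⊤)) (u : Γ(Y, ⊤)) (huu : IsUnit u)
    (h : ∀ d, ∀ x ∈ 𝒜 d, ψ x = u ^ d * φ x) (f g : A) {m m' : ℕ} (hf : f ∈ 𝒜 m)
    (hm : 0 < m) (hu : IsUnit (φ f)) (hg : g ∈ 𝒜 m') (hm' : 0 < m') (hu' : IsUnit (ψ g)) :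
    chart 𝒜 φ f hf hm hu = chart 𝒜 ψ g hg hm' hu' := by
  have h1 : IsUnit (φ g) := isUnit_of_mul_isUnit_right (by rw [← h _ _ hg]; exact hu')
  have h2 : IsUnit (ψ f) := by rw [h _ _ hf]; exact (huu.pow _).mul hu
  have h3 : IsUnit (φ (f * g)) := by rw [map_mul]; exact hu.mul h1
  have h4 : IsUnit (ψ (f * g)) := by rw [map_mul]; exact h2.mul hu'
  rw [← chart_mul 𝒜 φ f g hf hm hu hg h3,
    chart_scale 𝒜 φ ψ u h (f * g) _ _ h3 h4]
  have h5 : IsUnit (ψ (g * f)) := by rwa [mul_comm]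
  rw [← chart_mul 𝒜 ψ g f hg hm' hu' hf h5]
  congr 1 <;> simp only [mul_comm, add_comm]

/-- The structure morphism of `Proj` of a graded `k`-algebra. -/
def projStr : Proj 𝒜 ⟶ Spec (.of k) :=
  Proj.toSpecZero 𝒜 ≫ Spec.map (CommRingCat.ofHom (algebraMap k (𝒜 0)))

/-- The scalars of `k` as functions on a `k`-scheme. -/
def scalars {Y : Scheme.{u}} (p : Y ⟶ Spec (.of k)) : k →+* Γ(Y, ⊤) :=
  ((Scheme.ΓSpecIso (.of k)).inv ≫ p.appTop).hom

lemma scalars_comp {Z Y : Scheme.{u}} (g : Z ⟶ Y) (p : Y ⟶ Spec (.of k)) :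
    g.appTop.hom.comp (scalars p) = scalars (g ≫ p) := by
  ext x; simp only [scalars, Scheme.Hom.comp_appTop]; rfl

lemma toSpecΓ_scalars {Y : Scheme.{u}} (p : Y ⟶ Spec (.of k)) :
    Y.toSpecΓ ≫ Spec.map (CommRingCat.ofHom (scalars p)) = p := by
  simp [scalars, Spec.map_comp, ← Scheme.toSpecΓ_naturality_assoc]

lemma chart_projStr {Y : Scheme.{u}} (p : Y ⟶ Spec (.of k)) (φ : A →+* Γ(Y, ⊤))
    (hφ : φ.comp (algebraMap k A) = scalars p) (f : A) {m : ℕ} (hf : f ∈ 𝒜 m) (hm : 0 < m)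
    (hu : IsUnit (φ f)) : chart 𝒜 φ f hf hm hu ≫ projStr 𝒜 = p := by
  rw [chart, projStr, Category.assoc, Category.assoc, Proj.awayι_toSpecZero_assoc, ← Spec.map_comp,
    ← Spec.map_comp, ← CommRingCat.ofHom_comp, ← CommRingCat.ofHom_comp]
  conv_rhs => rw [← toSpecΓ_scalars p, ← hφ]
  congr 3
  ext c
  simp only [RingHom.comp_apply, awayLift]
  have : algebraMap (Away 𝒜 f) (Localization.Away f)
      (fromZeroRingHom 𝒜 (Submonoid.powers f) (algebraMap k (𝒜 0) c)) =
      algebraMap A _ (algebraMap k A c) := by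
    rw [HomogeneousLocalization.algebraMap_apply]
    exact Localization.mk_one_eq_algebraMap (M := Submonoid.powers f) (algebraMap k A c)
  rw [this]
  simp


section Glue

variable {Y : Scheme.{u}} {C : Type} (U : C → Y.Opens) (hU : TopologicalSpace.IsOpenCover U)
  (φ : ∀ c, A →+* Γ(U c, ⊤)) (f : C → A) (m : C → ℕ) (hf : ∀ c, f c ∈ 𝒜 (m c))
  (hm : ∀ c, 0 < m c) (hu : ∀ c, IsUnit (φ c (f c)))
  (compat : ∀ (c c' : C) (Z : Scheme.{u}) (a : Z ⟶ U c) (b : Z ⟶ U c'),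
    a ≫ (U c).ι = b ≫ (U c').ι → ∃ t : Γ(Z, ⊤), IsUnit t ∧
      ∀ d, ∀ x ∈ 𝒜 d, b.appTop.hom (φ c' x) = t ^ d * a.appTop.hom (φ c x))

/-- The morphism to `Proj 𝒜` obtained by gluing morphisms `chart` on an open cover; `compat` says that
on overlaps the ring maps differ by powers of an invertible function. -/
def glueCharts : Y ⟶ Proj 𝒜 :=
  (Y.openCoverOfIsOpenCover U hU).glueMorphisms
    (fun c ↦ chart 𝒜 (φ c) (f c) (hf c) (hm c) (hu c)) fun c c' ↦ by
      obtain ⟨t, ht, h⟩ := compat c c' _ (pullback.fst (U c).ι (U c').ι)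
        (pullback.snd (U c).ι (U c').ι) pullback.condition
      exact (comp_chart 𝒜 (pullback.fst (U c).ι (U c').ι) _ _ _ _ _).trans
        ((chart_eq 𝒜 _ _ t ht h _ _ _ _ _ _ _ _).trans (comp_chart 𝒜 _ _ _ _ _ _).symm)

lemma ι_glueCharts (c : C) : (U c).ι ≫ glueCharts 𝒜 U hU φ f m hf hm hu compat =
    chart 𝒜 (φ c) (f c) (hf c) (hm c) (hu c) :=
  (Y.openCoverOfIsOpenCover U hU).ι_glueMorphisms _ _ c

lemma glueCharts_projStr (p : Y ⟶ Spec (.of k))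
    (hφ : ∀ c, (φ c).comp (algebraMap k A) = scalars ((U c).ι ≫ p)) :
    glueCharts 𝒜 U hU φ f m hf hm hu compat ≫ projStr 𝒜 = p := by
  refine (Y.openCoverOfIsOpenCover U hU).hom_ext _ _ fun c ↦ ?_
  exact (Category.assoc _ _ _).symm.trans
    ((congrArg (· ≫ projStr 𝒜) (ι_glueCharts 𝒜 U hU φ f m hf hm hu compat c)).trans
      (chart_projStr 𝒜 _ _ (hφ c) _ _ _ _))

end Glue

end Charts

section Coordinates

variable (k : Type u) [Field k]

/-- Projective space over `k` with homogeneous coordinates indexed by `ι`. -/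
def projectiveSpace (ι : Type) : Over (Spec (.of k)) :=
  Over.mk (projStr (homogeneousSubmodule ι k))

variable {k} {ι : Type}

lemma X_mem (i : ι) : (X i : MvPolynomial ι k) ∈ homogeneousSubmodule ι k 1 :=
  isHomogeneous_X k i

/-- The standard open subset `x_i ≠ 0` of projective space. -/
abbrev stdOpen (i : ι) : (Proj (homogeneousSubmodule ι k)).Opens :=
  Proj.basicOpen (homogeneousSubmodule ι k) (X i)

lemma isOpenCover_stdOpen : TopologicalSpace.IsOpenCover (stdOpen (k := k) (ι := ι)) := by
  refine Proj.iSup_basicOpen_eq_top _ (fun i : ι ↦ X i) ?_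
  rw [HomogeneousIdeal.toIdeal_irrelevant_le]
  intro d hd p hp
  rw [← Set.image_univ]
  refine mem_ideal_span_X_image.mpr ?_
  intro m hm
  have h1 : m.degree = d := by
    have := hp (mem_support_iff.mp hm)
    rw [Finsupp.degree_eq_weight_one]
    exact this
  by_contra! h
  have : m = 0 := by ext i; simpa using h i
  simp [this] at h1
  omega

/-- The function `x_a / x_i` on the standard open subset `x_i ≠ 0`. -/
def ratio (i a : ι) : Γ(Proj (homogeneousSubmodule ι k), stdOpen i) :=
  (Proj.awayToSection (homogeneousSubmodule ι k) (X i)).hom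
    (Away.mk _ (X_mem i) 1 (X a) (X_mem a))

lemma ratio_self (i : ι) : ratio (k := k) i i = 1 := by
  have : Away.mk (homogeneousSubmodule ι k) (X_mem i) 1 (X i) (X_mem i) = 1 := by
    ext
    rw [Away.val_mk, val_one]
    simp only [pow_one]
    exact Localization.mk_self (⟨X i, 1, pow_one _⟩ : Submonoid.powers (X i : MvPolynomial ι k))
  rw [ratio, this, map_one]

lemma ratio_res (i j a : ι) :
    (Proj (homogeneousSubmodule ι k)).presheaf.map
      (homOfLE (Proj.basicOpen_mono _ (X i) (X i * X j) ⟨_, rfl⟩)).op (ratio i a) =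
    (Proj.awayToSection (homogeneousSubmodule ι k) (X i * X j)).hom
      (awayMap _ (X_mem j) rfl (Away.mk _ (X_mem i) 1 (X a) (X_mem a))) :=
  (ConcreteCategory.congr_hom
    (Proj.awayMap_awayToSection (homogeneousSubmodule ι k) (X_mem j) (f := X i) rfl) _).symm

lemma ratio_res' (i j a : ι) :
    (Proj (homogeneousSubmodule ι k)).presheaf.map
      (homOfLE (Proj.basicOpen_mono _ (X j) (X i * X j) ⟨_, mul_comm _ _⟩)).op (ratio j a) =
    (Proj.awayToSection (homogeneousSubmodule ι k) (X i * X j)).hom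
      (awayMap _ (X_mem i) (mul_comm _ _) (Away.mk _ (X_mem j) 1 (X a) (X_mem a))) :=
  (ConcreteCategory.congr_hom
    (Proj.awayMap_awayToSection (homogeneousSubmodule ι k) (X_mem i) (f := X j)
      (mul_comm _ _)) _).symm

/-- For a morphism `g` to projective space with image in `x_i ≠ 0`, the function `x_a / x_i`
pulled back along `g`. -/
def coord {Y : Scheme.{u}} (g : Y ⟶ Proj (homogeneousSubmodule ι k)) (i : ι)
    (h : ⊤ ≤ g ⁻¹ᵁ stdOpen i) (a : ι) : Γ(Y, ⊤) :=
  (g.appLE (stdOpen i) ⊤ h).hom (ratio i a)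

lemma coord_self {Y : Scheme.{u}} (g : Y ⟶ Proj (homogeneousSubmodule ι k)) (i : ι)
    (h : ⊤ ≤ g ⁻¹ᵁ stdOpen i) : coord g i h i = 1 := by
  rw [coord, ratio_self, map_one]

lemma comp_coord {Z Y : Scheme.{u}} (f : Z ⟶ Y) (g : Y ⟶ Proj (homogeneousSubmodule ι k)) (i : ι)
    (h : ⊤ ≤ g ⁻¹ᵁ stdOpen i) (h' : ⊤ ≤ (f ≫ g) ⁻¹ᵁ stdOpen i) (a : ι) :
    f.appTop.hom (coord g i h a) = coord (f ≫ g) i h' a := by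
  have h1 : f.appLE ⊤ ⊤ le_top = f.appTop := by
    simp only [Scheme.Hom.appLE, Scheme.Hom.appTop]
    exact (congrArg (f.app ⊤ ≫ ·) (Z.presheaf.map_id _)).trans (Category.comp_id _)
  have h2 := Scheme.Hom.appLE_comp_appLE f g (stdOpen i) ⊤ ⊤ h le_top
  rw [h1] at h2
  rw [coord, coord, ← h2]
  rfl

lemma coord_congr {Y : Scheme.{u}} {g g' : Y ⟶ Proj (homogeneousSubmodule ι k)} (e : g = g')
    (i : ι) (h : ⊤ ≤ g ⁻¹ᵁ stdOpen i) (h' : ⊤ ≤ g' ⁻¹ᵁ stdOpen i) (a : ι) :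
    coord g i h a = coord g' i h' a := by
  subst e; rfl

lemma coord_change {Y : Scheme.{u}} (g : Y ⟶ Proj (homogeneousSubmodule ι k)) (i j : ι)
    (hi : ⊤ ≤ g ⁻¹ᵁ stdOpen i) (hj : ⊤ ≤ g ⁻¹ᵁ stdOpen j) (a : ι) :
    coord g j hj a = coord g j hj i * coord g i hi a := by
  have hij : ⊤ ≤ g ⁻¹ᵁ Proj.basicOpen (homogeneousSubmodule ι k) (X i * X j) := by
    rw [Proj.basicOpen_mul]
    exact le_inf hi hj
  have e1 (b : ι) : coord g i hi b = (g.appLE _ ⊤ hij).hom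
      ((Proj.awayToSection (homogeneousSubmodule ι k) (X i * X j)).hom
      (awayMap _ (X_mem j) rfl (Away.mk _ (X_mem i) 1 (X b) (X_mem b)))) := by
    rw [← ratio_res, coord, ← Scheme.Hom.map_appLE g hij
      (homOfLE (Proj.basicOpen_mono _ (X i) (X i * X j) ⟨_, rfl⟩)).op]
    rfl
  have e2 (b : ι) : coord g j hj b = (g.appLE _ ⊤ hij).hom
      ((Proj.awayToSection (homogeneousSubmodule ι k) (X i * X j)).hom
      (awayMap _ (X_mem i) (mul_comm _ _) (Away.mk _ (X_mem j) 1 (X b) (X_mem b)))) := by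
    rw [← ratio_res', coord, ← Scheme.Hom.map_appLE g hij
      (homOfLE (Proj.basicOpen_mono _ (X j) (X i * X j) ⟨_, mul_comm _ _⟩)).op]
    rfl
  rw [e1, e2, e2, ← map_mul, ← map_mul]
  congr 2
  ext
  rw [val_mul, awayMap_mk, awayMap_mk, awayMap_mk, Away.val_mk, Away.val_mk, Away.val_mk,
    Localization.mk_mul, Localization.mk_eq_mk_iff, Localization.r_iff_exists]
  refine ⟨1, ?_⟩
  simp
  ring

lemma coord_isUnit {Y : Scheme.{u}} (g : Y ⟶ Proj (homogeneousSubmodule ι k)) (i j : ι)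
    (hi : ⊤ ≤ g ⁻¹ᵁ stdOpen i) (hj : ⊤ ≤ g ⁻¹ᵁ stdOpen j) : IsUnit (coord g j hj i) := by
  refine IsUnit.of_mul_eq_one (coord g i hi j) ?_
  rw [← coord_change, coord_self]

end Coordinates

section Segre

variable {k : Type u} [Field k]

lemma eval₂_scale {σ : Type} {R : Type u} {M : Type} [CommRing R] [AddCommMonoid M] (w : σ → M)
    (χ : Multiplicative M →* R) (f : k →+* R) (x y : σ → R) (hxy : ∀ i, y i = χ (.ofAdd (w i)) * x i)
    (p : MvPolynomial σ k) (m : M) (hp : IsWeightedHomogeneous w p m) :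
    eval₂ f y p = χ (.ofAdd m) * eval₂ f x p := by
  rw [eval₂_eq, eval₂_eq, Finset.mul_sum]
  refine Finset.sum_congr rfl fun d hd ↦ ?_
  have h : ∏ i ∈ d.support, χ (.ofAdd (w i)) ^ d i = χ (.ofAdd m) := by
    rw [← hp (mem_support_iff.mp hd), Finsupp.weight_apply, Finsupp.sum, ofAdd_sum, map_prod]
    simp [ofAdd_nsmul]
  simp only [hxy, mul_pow, Finset.prod_mul_distrib, h]
  ring

variable {ι κ : Type}

lemma top_le_preimage_ι {Y W : Scheme.{u}} (g : Y ⟶ W) (U : Y.Opens) (V : W.Opens)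
    (h : U ≤ g ⁻¹ᵁ V) : ⊤ ≤ (U.ι ≫ g) ⁻¹ᵁ V := by
  intro x _
  exact h x.2

/-- The composite of `(g, g')` with the Segre embedding. On the open subset where `x_i ≠ 0` and
`y_j ≠ 0`, it substitutes `(x_a / x_i) (y_b / y_j)` for the coordinate with index `(a, b)`. -/
def segreHom {Y : Scheme.{u}} (p : Y ⟶ Spec (.of k)) (g : Y ⟶ Proj (homogeneousSubmodule ι k))
    (g' : Y ⟶ Proj (homogeneousSubmodule κ k)) : Y ⟶ Proj (homogeneousSubmodule (ι × κ) k) :=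
  glueCharts (homogeneousSubmodule (ι × κ) k) (C := ι × κ)
    (fun c ↦ g ⁻¹ᵁ stdOpen c.1 ⊓ g' ⁻¹ᵁ stdOpen c.2)
    (by
      refine TopologicalSpace.IsOpenCover.mk (top_unique fun y _ ↦ ?_)
      obtain ⟨i, hi⟩ := isOpenCover_stdOpen.exists_mem (g y)
      obtain ⟨j, hj⟩ := isOpenCover_stdOpen.exists_mem (g' y)
      exact TopologicalSpace.Opens.mem_iSup.mpr ⟨(i, j), hi, hj⟩)
    (fun c ↦ eval₂Hom (scalars (Scheme.Opens.ι _ ≫ p)) fun a ↦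
      coord (Scheme.Opens.ι _ ≫ g) c.1 (top_le_preimage_ι _ _ _ inf_le_left) a.1 *
      coord (Scheme.Opens.ι _ ≫ g') c.2 (top_le_preimage_ι _ _ _ inf_le_right) a.2)
    X (fun _ ↦ 1) X_mem (fun _ ↦ one_pos)
    (fun c ↦ by
      rw [coe_eval₂Hom, eval₂_X, coord_self, coord_self, one_mul]
      exact isUnit_one)
    (by
      rintro c c' Z a b h
      have e : a ≫ Scheme.Opens.ι _ ≫ g = b ≫ Scheme.Opens.ι _ ≫ g := by
        rw [← Category.assoc, h, Category.assoc]
      have e' : a ≫ Scheme.Opens.ι _ ≫ g' = b ≫ Scheme.Opens.ι _ ≫ g' := by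
        rw [← Category.assoc, h, Category.assoc]
      have ha : ⊤ ≤ (a ≫ Scheme.Opens.ι _ ≫ g) ⁻¹ᵁ stdOpen c.1 :=
        fun z _ ↦ (a z).2.1
      have ha' : ⊤ ≤ (a ≫ Scheme.Opens.ι _ ≫ g') ⁻¹ᵁ stdOpen c.2 :=
        fun z _ ↦ (a z).2.2
      have hb : ⊤ ≤ (a ≫ Scheme.Opens.ι _ ≫ g) ⁻¹ᵁ stdOpen c'.1 := by
        rw [e]; exact fun z _ ↦ (b z).2.1
      have hb' : ⊤ ≤ (a ≫ Scheme.Opens.ι _ ≫ g') ⁻¹ᵁ stdOpen c'.2 := by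
        rw [e']; exact fun z _ ↦ (b z).2.2
      obtain ⟨t, ht⟩ : ∃ t, t = coord _ _ hb c.1 * coord _ _ hb' c.2 := ⟨_, rfl⟩
      refine ⟨t, ht ▸ (coord_isUnit _ _ _ ha hb).mul (coord_isUnit _ _ _ ha' hb'), fun d x hx ↦ ?_⟩
      have hs : scalars (b ≫ Scheme.Opens.ι _ ≫ p) = scalars (a ≫ Scheme.Opens.ι _ ≫ p) := by
        rw [← Category.assoc, ← h, Category.assoc]
      simp only [coe_eval₂Hom, hom_eval₂, scalars_comp, hs]
      refine eval₂_scale (M := ℕ) 1 (powersHom _ t) _ _ _ (fun s ↦ ?_) x d hx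
      simp only [map_mul]
      rw [comp_coord a _ _ _ ha, comp_coord a _ _ _ ha', comp_coord b _ _ _ (by rw [← e]; exact hb),
        comp_coord b _ _ _ (by rw [← e']; exact hb'), ← coord_congr e _ hb, ← coord_congr e' _ hb',
        coord_change _ _ _ ha hb, coord_change _ _ _ ha' hb']
      simp [ht]
      ring)

lemma segreHom_projStr {Y : Scheme.{u}} (p : Y ⟶ Spec (.of k))
    (g : Y ⟶ Proj (homogeneousSubmodule ι k)) (g' : Y ⟶ Proj (homogeneousSubmodule κ k)) :
    segreHom p g g' ≫ projStr _ = p :=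
  glueCharts_projStr _ _ _ _ _ _ _ _ _ _ p fun c ↦ by
    ext x
    simp [algebraMap_eq]

end Segre

section ProjMaps

variable {k : Type u} [Field k] {A B : Type u} [CommRing A] [Algebra k A] [CommRing B] [Algebra k B]
  {𝒜 : ℕ → Submodule k A} [GradedAlgebra 𝒜] {ℬ : ℕ → Submodule k B} [GradedAlgebra ℬ]

lemma irrelevant_le_map (f : 𝒜 →+*ᵍ ℬ) (hf : ∀ d, 0 < d → ∀ y ∈ ℬ d, ∃ x ∈ 𝒜 d, f x = y) :
    HomogeneousIdeal.irrelevant ℬ ≤ (HomogeneousIdeal.irrelevant 𝒜).map f := by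
  rw [HomogeneousIdeal.irrelevant_le]
  intro d hd y hy
  obtain ⟨x, hx, rfl⟩ := hf d hd y hy
  exact Ideal.mem_map_of_mem f.toRingHom (HomogeneousIdeal.mem_irrelevant_of_mem 𝒜 hd hx)

lemma awayι_map_projStr (f : 𝒜 →+*ᵍ ℬ)
    (hf : HomogeneousIdeal.irrelevant ℬ ≤ (HomogeneousIdeal.irrelevant 𝒜).map f)
    (hk : ∀ c : k, f (algebraMap k A c) = algebraMap k B c) (i : ℕ) (hi : 0 < i) (s : A)
    (hs : s ∈ 𝒜 i) :
    Proj.awayι ℬ (f s) (f.2 hs) hi ≫ Proj.map f hf ≫ projStr 𝒜 =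
      Proj.awayι ℬ (f s) (f.2 hs) hi ≫ projStr ℬ := by
  rw [projStr, projStr, Proj.awayι_comp_map_assoc f hf hi _ hs,
    Proj.awayι_toSpecZero_assoc, Proj.awayι_toSpecZero_assoc, ← Spec.map_comp, ← Spec.map_comp,
    ← Spec.map_comp, ← CommRingCat.ofHom_comp, ← CommRingCat.ofHom_comp, ← CommRingCat.ofHom_comp]
  congr 2
  ext c
  change Localization.mk (f (algebraMap k A c)) ⟨f 1, _⟩ =
    Localization.mk (algebraMap k B c) ⟨1, _⟩
  simp only [hk, map_one]

lemma map_projStr (f : 𝒜 →+*ᵍ ℬ)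
    (hf : HomogeneousIdeal.irrelevant ℬ ≤ (HomogeneousIdeal.irrelevant 𝒜).map f)
    (hk : ∀ c : k, f (algebraMap k A c) = algebraMap k B c) :
    Proj.map f hf ≫ projStr 𝒜 = projStr ℬ :=
  (Proj.mapAffineOpenCover f hf).openCover.hom_ext _ _ fun s ↦
    awayι_map_projStr f hf hk s.1.1 s.1.2 s.2.1 s.2.2

/-- The degree-`d` piece of the quotient of a graded algebra by a homogeneous ideal. -/
def quotientPiece (I : HomogeneousIdeal 𝒜) (d : ℕ) : Submodule k (A ⧸ I.toIdeal) :=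
  (𝒜 d).map (Ideal.Quotient.mkₐ k I.toIdeal).toLinearMap

/-- The projection from `A_d` to `(A / I)_d`. -/
def quotientPieceMap (I : HomogeneousIdeal 𝒜) (d : ℕ) : 𝒜 d →ₗ[k] quotientPiece I d :=
  (Ideal.Quotient.mkₐ k I.toIdeal).toLinearMap.restrict fun _ hx ↦ ⟨_, hx, rfl⟩

lemma quotientPiece_isInternal (I : HomogeneousIdeal 𝒜) :
    DirectSum.IsInternal (quotientPiece I) := by
  let T := DirectSum.map fun d ↦ (quotientPieceMap I d).toAddMonoidHom
  have hT : Function.Surjective T := (DirectSum.map_surjective _).mpr fun d ⟨_, x, hx, h⟩ ↦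
    ⟨⟨x, hx⟩, Subtype.ext h⟩
  have key : ∀ y, DirectSum.coeAddMonoidHom (quotientPiece I) (T y) =
      Ideal.Quotient.mk I.toIdeal (DirectSum.coeAddMonoidHom 𝒜 y) := by
    intro y
    induction y using DirectSum.induction_on with
    | zero => simp
    | of d x =>
      rw [DirectSum.map_of, DirectSum.coeAddMonoidHom_of, DirectSum.coeAddMonoidHom_of]
      rfl
    | add x y hx hy => rw [map_add, map_add, hx, hy, map_add, map_add]
  constructor
  · refine (injective_iff_map_eq_zero _).mpr fun z hz ↦ ?_
    obtain ⟨y, rfl⟩ := hT z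
    rw [key, Ideal.Quotient.eq_zero_iff_mem] at hz
    refine DFinsupp.ext fun d ↦ Subtype.ext ?_
    have := I.isHomogeneous d hz
    rw [show DirectSum.coeAddMonoidHom 𝒜 y = (DirectSum.decompose 𝒜).symm y from rfl,
      Equiv.apply_symm_apply] at this
    exact Ideal.Quotient.eq_zero_iff_mem.mpr this
  · intro z
    obtain ⟨x, rfl⟩ := Ideal.Quotient.mk_surjective z
    exact ⟨T (DirectSum.decompose 𝒜 x), (key _).trans
      (congrArg _ ((DirectSum.decompose 𝒜).symm_apply_apply x))⟩

instance (I : HomogeneousIdeal 𝒜) : SetLike.GradedMonoid (quotientPiece I) where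
  one_mem := ⟨1, SetLike.GradedOne.one_mem, map_one (Ideal.Quotient.mkₐ k I.toIdeal)⟩
  mul_mem := by
    rintro i j _ _ ⟨x, hx, rfl⟩ ⟨y, hy, rfl⟩
    exact ⟨x * y, SetLike.mul_mem_graded hx hy, map_mul (Ideal.Quotient.mkₐ k I.toIdeal) _ _⟩

instance (I : HomogeneousIdeal 𝒜) : GradedAlgebra (quotientPiece I) where
  toDecomposition := (quotientPiece_isInternal I).chooseDecomposition

/-- The quotient map of a graded algebra by a homogeneous ideal. -/
def quotientHom (I : HomogeneousIdeal 𝒜) : 𝒜 →+*ᵍ quotientPiece I where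
  toRingHom := Ideal.Quotient.mk I.toIdeal
  map_mem hx := ⟨_, hx, rfl⟩

/-- The closed immersion `Proj (A / I) ⟶ Proj A`. -/
def projQuotientι (I : HomogeneousIdeal 𝒜) : Proj (quotientPiece I) ⟶ Proj 𝒜 :=
  Proj.map (quotientHom I) (irrelevant_le_map _ fun _ _ _ ⟨x, hx, h⟩ ↦ ⟨x, hx, h⟩)

end ProjMaps

section Relabel
variable (k : Type u) [Field k] {ι κ : Type}

/-- The map of homogeneous coordinate rings induced by a bijection of the variables. -/
def renameHom (e : ι ≃ κ) : homogeneousSubmodule κ k →+*ᵍ homogeneousSubmodule ι k where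
  toRingHom := (rename e.symm : MvPolynomial κ k →ₐ[k] MvPolynomial ι k).toRingHom
  map_mem hx := hx.rename_isHomogeneous

/-- The isomorphism of projective spaces induced by a bijection `e` of the homogeneous coordinates,
sending the point with coordinates `x` to the point with coordinates `x ∘ e.symm`. -/
def relabel (e : ι ≃ κ) : projectiveSpace k ι ⟶ projectiveSpace k κ :=
  Over.homMk (Proj.map (renameHom k e) (irrelevant_le_map _ fun d _ y hy ↦
      ⟨rename e y, hy.rename_isHomogeneous, by
        change rename e.symm (rename e y) = y
        rw [rename_rename]; simp⟩))
    (map_projStr _ _ fun c ↦ by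
      change rename e.symm (algebraMap k _ c) = _
      simp [algebraMap_eq])

end Relabel

section CartesianProduct

variable (k : Type u) [Field k] {J : Type} (ι : J → Type)

open scoped Classical in
/-- The multidegree of the variables of `⨂_j k[x_a : a ∈ ι j] = k[x_{j,a}]`. -/
def multidegree (x : Σ j, ι j) : J → ℕ := Pi.single x.1 1

/-- The polynomials that are homogeneous of degree `d` in each of the families of variables
`(x_{j,a})_a`, that is, the image of `⨂_j k[x_a : a ∈ ι j]_d`. -/
def diagonalPiece (d : ℕ) : Submodule k (MvPolynomial (Σ j, ι j) k) :=
  weightedHomogeneousSubmodule k (multidegree ι) fun _ ↦ d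

instance : SetLike.GradedMonoid (diagonalPiece k ι) where
  one_mem := isWeightedHomogeneous_one k _
  mul_mem _ _ _ _ hp hq := IsWeightedHomogeneous.mul hp hq

/-- The Cartesian product of the polynomial rings `k[x_a : a ∈ ι j]`, that is, the subring
`⨁_d ⨂_j k[x_a : a ∈ ι j]_d` of the tensor product `⨂_j k[x_a : a ∈ ι j] = k[x_{j,a}]`. -/
def Cartesian : Subalgebra k (MvPolynomial (Σ j, ι j) k) :=
  (DirectSum.coeAlgHom (diagonalPiece k ι)).range

/-- The degree-`d` piece `⨂_j k[x_a : a ∈ ι j]_d` of the Cartesian product. -/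
def cartesianPiece (d : ℕ) : Submodule k (Cartesian k ι) :=
  (diagonalPiece k ι d).comap (Cartesian k ι).val.toLinearMap

instance : SetLike.GradedMonoid (cartesianPiece k ι) where
  one_mem := isWeightedHomogeneous_one k _
  mul_mem _ _ _ _ hp hq := IsWeightedHomogeneous.mul hp hq

lemma coeAlgHom_diagonalPiece_injective [Nonempty J] :
    Function.Injective (DirectSum.coeAlgHom (diagonalPiece k ι)) := by
  classical
  let _ := weightedDecomposition k (multidegree ι)
  have h : iSupIndep fun m ↦ weightedHomogeneousSubmodule k (multidegree ι) m :=
    (DirectSum.Decomposition.isInternal _).submodule_iSupIndep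
  have hc : Function.Injective fun (d : ℕ) (_ : J) ↦ d := Function.const_injective
  exact (h.comp hc).dfinsupp_lsum_injective

lemma diagonalPiece_le (d : ℕ) (x : diagonalPiece k ι d) :
    (x : MvPolynomial (Σ j, ι j) k) ∈ Cartesian k ι :=
  ⟨DirectSum.of (fun d ↦ diagonalPiece k ι d) d x, DirectSum.coeAlgHom_of _ _ _⟩

lemma cartesianPiece_isInternal [Nonempty J] : DirectSum.IsInternal (cartesianPiece k ι) := by
  let t (d : ℕ) : diagonalPiece k ι d →+ cartesianPiece k ι d :=
    { toFun x := ⟨⟨x, diagonalPiece_le k ι d x⟩, x.2⟩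
      map_zero' := rfl
      map_add' _ _ := rfl }
  let T := DirectSum.map t
  have hT : Function.Surjective T := (DirectSum.map_surjective _).mpr fun d x ↦
    ⟨⟨x.1.1, x.2⟩, rfl⟩
  have key : ∀ y, (DirectSum.coeAddMonoidHom (cartesianPiece k ι) (T y)).1 =
      DirectSum.coeAlgHom (diagonalPiece k ι) y := by
    intro y
    induction y using DirectSum.induction_on with
    | zero => simp
    | of d x =>
      rw [DirectSum.map_of, DirectSum.coeAddMonoidHom_of, DirectSum.coeAlgHom_of]
      rfl
    | add x y hx hy => rw [map_add, map_add, map_add, ← hx, ← hy]; rfl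
  constructor
  · intro z z' h
    obtain ⟨y, rfl⟩ := hT z
    obtain ⟨y', rfl⟩ := hT z'
    have h' := congrArg Subtype.val h
    rw [key, key] at h'
    rw [coeAlgHom_diagonalPiece_injective k ι h']
  · rintro ⟨_, y, rfl⟩
    exact ⟨T y, Subtype.ext (key y)⟩

instance [Nonempty J] : GradedAlgebra (cartesianPiece k ι) where
  toDecomposition := (cartesianPiece_isInternal k ι).chooseDecomposition

end CartesianProduct

section ToProjCartesian

variable {k : Type u} [Field k] {J : Type} [Fintype J] {ι : J → Type}
  {Y : Scheme.{u}} (g : ∀ j, Y ⟶ Proj (homogeneousSubmodule (ι j) k))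

/-- The open subset of `Y` where the `c j`-th homogeneous coordinate of `g j` does not vanish for
any `j`. -/
def boxOpen (c : ∀ j, ι j) : Y.Opens :=
  ⟨⋂ j, (g j ⁻¹ᵁ stdOpen (c j) : Set Y), isOpen_iInter_of_finite fun j ↦
    (g j ⁻¹ᵁ stdOpen (c j)).2⟩

lemma boxOpen_le (c : ∀ j, ι j) (j : J) : boxOpen g c ≤ g j ⁻¹ᵁ stdOpen (c j) :=
  fun _ hx ↦ Set.mem_iInter.mp hx j

lemma boxOpen_top_le (c : ∀ j, ι j) (j : J) :
    ⊤ ≤ ((boxOpen g c).ι ≫ g j) ⁻¹ᵁ stdOpen (c j) :=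
  top_le_preimage_ι (g j) (boxOpen g c) (stdOpen (c j)) (boxOpen_le g c j)

variable (k) in
lemma monomial_mem (c : ∀ j, ι j) :
    (∏ j, X ⟨j, c j⟩ : MvPolynomial (Σ j, ι j) k) ∈ diagonalPiece k ι 1 := by
  classical
  have h (j : J) : IsWeightedHomogeneous (multidegree ι) (X (⟨j, c j⟩ : Σ j, ι j) :
      MvPolynomial (Σ j, ι j) k) (Pi.single j 1) := by
    have := isWeightedHomogeneous_X k (multidegree ι) ⟨j, c j⟩
    simp only [multidegree] at this
    convert this
  have e : ∑ j : J, (Pi.single j 1 : J → ℕ) = fun _ ↦ 1 := by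
    ext j
    simp [Finset.sum_apply, Pi.single_apply]
  have := IsWeightedHomogeneous.prod (R := k) (w := multidegree ι) Finset.univ _ _ fun j _ ↦ h j
  rw [e] at this
  exact this

/-- The element `∏_j x_{j, c j}` of the Cartesian product. -/
def boxMonomial (c : ∀ j, ι j) : Cartesian k ι := ⟨_, diagonalPiece_le k ι 1 ⟨_, monomial_mem k c⟩⟩

lemma coe_boxMonomial (c : ∀ j, ι j) : ((boxMonomial c : Cartesian k ι) :
    MvPolynomial (Σ j, ι j) k) = ∏ j, X ⟨j, c j⟩ := rfl

/-- The function `x_{j,a} / x_{j, c j}` on `boxOpen g c`. -/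
def boxCoord (c : ∀ j, ι j) (s : Σ j, ι j) : Γ(boxOpen g c, ⊤) :=
  coord ((boxOpen g c).ι ≫ g s.1) (c s.1) (boxOpen_top_le g c s.1) s.2

/-- Substitution of `x_{j,a} / x_{j, c j}` for `x_{j,a}`. -/
def boxHom (p : Y ⟶ Spec (.of k)) (c : ∀ j, ι j) : Cartesian k ι →+* Γ(boxOpen g c, ⊤) :=
  RingHom.comp (eval₂Hom (scalars ((boxOpen g c).ι ≫ p)) (boxCoord g c))
    (algebraMap (Cartesian k ι) (MvPolynomial (Σ j, ι j) k))

lemma isOpenCover_boxOpen : TopologicalSpace.IsOpenCover (boxOpen g) := by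
  refine TopologicalSpace.IsOpenCover.mk (top_unique fun y _ ↦ ?_)
  choose c hc using fun j ↦ isOpenCover_stdOpen.exists_mem (g j y)
  exact TopologicalSpace.Opens.mem_iSup.mpr ⟨c, Set.mem_iInter.mpr hc⟩

lemma boxCoord_self (c : ∀ j, ι j) (j : J) : boxCoord g c ⟨j, c j⟩ = 1 :=
  coord_self _ _ _

lemma boxHom_apply (p : Y ⟶ Spec (.of k)) (c : ∀ j, ι j) (x : Cartesian k ι) :
    boxHom g p c x = eval₂Hom (scalars ((boxOpen g c).ι ≫ p)) (boxCoord g c) x.1 := rfl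

lemma boxHom_isUnit (p : Y ⟶ Spec (.of k)) (c : ∀ j, ι j) :
    IsUnit (boxHom g p c (boxMonomial c)) := by
  have : boxHom g p c (boxMonomial c) = 1 := by
    rw [boxHom_apply, coe_boxMonomial, map_prod]
    refine Finset.prod_eq_one fun j _ ↦ ?_
    rw [coe_eval₂Hom, eval₂_X, boxCoord_self]
  rw [this]
  exact isUnit_one

lemma boxHom_compat (p : Y ⟶ Spec (.of k)) (c c' : ∀ j, ι j) (Z : Scheme.{u})
    (a : Z ⟶ boxOpen g c) (b : Z ⟶ boxOpen g c')
    (h : a ≫ (boxOpen g c).ι = b ≫ (boxOpen g c').ι) : ∃ t : Γ(Z, ⊤), IsUnit t ∧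
      ∀ d, ∀ x ∈ cartesianPiece k ι d,
        b.appTop.hom (boxHom g p c' x) = t ^ d * a.appTop.hom (boxHom g p c x) := by
  have e (j) : a ≫ (boxOpen g c).ι ≫ g j = b ≫ (boxOpen g c').ι ≫ g j := by
    rw [← Category.assoc, h, Category.assoc]
  have ha (j) : ⊤ ≤ (a ≫ (boxOpen g c).ι ≫ g j) ⁻¹ᵁ stdOpen (c j) :=
    fun z _ ↦ boxOpen_le g c j (a z).2
  have hb' (j) : ⊤ ≤ (b ≫ (boxOpen g c').ι ≫ g j) ⁻¹ᵁ stdOpen (c' j) :=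
    fun z _ ↦ boxOpen_le g c' j (b z).2
  have hb (j) : ⊤ ≤ (a ≫ (boxOpen g c).ι ≫ g j) ⁻¹ᵁ stdOpen (c' j) := by
    rw [e]; exact hb' j
  obtain ⟨v, hv⟩ : ∃ v : J → Γ(Z, ⊤), ∀ j, v j = coord _ _ (hb j) (c j) := ⟨_, fun _ ↦ rfl⟩
  have key (s : Σ j, ι j) : b.appTop.hom (boxCoord g c' s) =
      v s.1 * a.appTop.hom (boxCoord g c s) := by
    rw [boxCoord, boxCoord, comp_coord a _ _ _ (ha s.1), comp_coord b _ _ _ (hb' s.1),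
      ← coord_congr (e s.1) _ (hb s.1), coord_change _ _ _ (ha s.1) (hb s.1), hv]
  refine ⟨∏ j, v j, ?_, fun d x hx ↦ ?_⟩
  · exact IsUnit.prod_univ_iff.mpr fun j ↦ hv j ▸ coord_isUnit _ _ _ (ha j) (hb j)
  have hs : scalars (b ≫ (boxOpen g c').ι ≫ p) = scalars (a ≫ (boxOpen g c).ι ≫ p) := by
    rw [← Category.assoc, ← h, Category.assoc]
  rw [boxHom_apply, boxHom_apply, coe_eval₂Hom, coe_eval₂Hom]
  rw [hom_eval₂, hom_eval₂, scalars_comp, scalars_comp, hs]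
  let χ : Multiplicative (J → ℕ) →* Γ(Z, ⊤) :=
    { toFun m := ∏ j, v j ^ m.toAdd j
      map_one' := by simp
      map_mul' m m' := by simp [pow_add, Finset.prod_mul_distrib] }
  have hχ (s : Σ j, ι j) : χ (.ofAdd (multidegree ι s)) = v s.1 := by
    classical
    simp only [χ, MonoidHom.coe_mk, OneHom.coe_mk, toAdd_ofAdd, multidegree]
    rw [Finset.prod_eq_single s.1] <;> simp +contextual
  have := eval₂_scale (multidegree ι) χ (scalars (a ≫ (boxOpen g c).ι ≫ p))
    (a.appTop.hom ∘ boxCoord g c) (b.appTop.hom ∘ boxCoord g c')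
    (fun s ↦ by rw [hχ]; exact key s) x.1 _ hx
  refine this.trans ?_
  congr 1
  simp [χ, Finset.prod_pow]

/-- For a `k`-scheme `Y` and morphisms `g j` to projective spaces, the morphism from `Y` to `Proj`
of the Cartesian product of the homogeneous coordinate rings. On the open subset where
`x_{j, c j} ≠ 0` for all `j`, it is given by substituting `x_{j,a} / x_{j, c j}` for `x_{j,a}`. -/
def toProjCartesian [Nonempty J] (p : Y ⟶ Spec (.of k)) : Y ⟶ Proj (cartesianPiece k ι) :=
  glueCharts (cartesianPiece k ι) (boxOpen g) (isOpenCover_boxOpen g) (boxHom g p)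
    boxMonomial (fun _ ↦ 1) (fun c ↦ monomial_mem k c) (fun _ ↦ one_pos)
    (boxHom_isUnit g p) (boxHom_compat g p)

end ToProjCartesian

section OverMaps

variable {k : Type u} [Field k] {ι κ : Type}

/-- The Segre embedding `ℙ(ι) × ℙ(κ) ⟶ ℙ(ι × κ)`. -/
def segre : projectiveSpace k ι ⨯ projectiveSpace k κ ⟶ projectiveSpace k (ι × κ) :=
  Over.homMk (segreHom (projectiveSpace k ι ⨯ projectiveSpace k κ).hom
    (prod.fst : projectiveSpace k ι ⨯ projectiveSpace k κ ⟶ _).left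
    (prod.snd : projectiveSpace k ι ⨯ projectiveSpace k κ ⟶ _).left) (segreHom_projStr _ _ _)

/-- The canonical morphism (an isomorphism) from a product of projective spaces to `Proj` of the
Cartesian product of their homogeneous coordinate rings. -/
def prodToProj {J : Type} [Fintype J] [Nonempty J] (ι : J → Type) :
    (∏ᶜ fun j ↦ projectiveSpace k (ι j)).left ⟶ Proj (cartesianPiece k ι) :=
  toProjCartesian (fun j ↦ (Pi.π (fun j ↦ projectiveSpace k (ι j)) j).left)
    (∏ᶜ fun j ↦ projectiveSpace k (ι j)).hom

end OverMaps

section Logic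

/-- Formulas of unit-free multiplicative linear logic in negation normal form; `atom x true` is the
atom `x`, and `atom x false` is its negation. -/
inductive Formula (V : Type v) : Type v
  | atom (x : V) (positive : Bool)
  | tensor (A B : Formula V)
  | par (A B : Formula V)

namespace Formula
variable {V : Type v}

/-- Linear negation, with `¬(A ⊗ B) = ¬B ⅋ ¬A` and `¬(A ⅋ B) = ¬B ⊗ ¬A`. -/
def neg : Formula V → Formula V
  | atom x b => atom x !b
  | tensor A B => par B.neg A.neg
  | par A B => tensor B.neg A.neg

/-- The index set of the homogeneous coordinates of the projective space of a formula: a choice of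
one of two coordinates for every occurrence of an atom. -/
def Coord : Formula V → Type
  | atom _ _ => Fin 2
  | tensor A B => A.Coord × B.Coord
  | par A B => A.Coord × B.Coord

/-- The number of occurrences of atoms. -/
def numAtoms : Formula V → ℕ
  | atom _ _ => 1
  | tensor A B => A.numAtoms + B.numAtoms
  | par A B => A.numAtoms + B.numAtoms

lemma card_coord (A : Formula V) : Nat.card A.Coord = 2 ^ A.numAtoms := by
  induction A with
  | atom x b => exact Nat.card_fin 2
  | tensor A B hA hB =>
    rw [numAtoms, pow_add, ← hA, ← hB]
    exact Nat.card_prod _ _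
  | par A B hA hB =>
    rw [numAtoms, pow_add, ← hA, ← hB]
    exact Nat.card_prod _ _

/-- The identification of the coordinates of `A` and `¬A`, which matches the coordinate of an
occurrence of an atom in `A` with the coordinate of the dual occurrence in `¬A`. -/
def negCoord : (A : Formula V) → A.Coord ≃ A.neg.Coord
  | atom _ _ => Equiv.refl _
  | tensor A B => (Equiv.prodComm _ _).trans (Equiv.prodCongr B.negCoord A.negCoord)
  | par A B => (Equiv.prodComm _ _).trans (Equiv.prodCongr B.negCoord A.negCoord)

/-- The Boolean value of a formula under the valuation that makes every variable true. -/
def eval : Formula V → Bool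
  | atom _ b => b
  | tensor A B => A.eval && B.eval
  | par A B => A.eval || B.eval

lemma eval_neg (A : Formula V) : A.neg.eval = !A.eval := by
  induction A with
  | atom x b => rfl
  | tensor A B hA hB => simp [neg, eval, hA, hB, Bool.or_comm]
  | par A B hA hB => simp [neg, eval, hA, hB, Bool.and_comm]

end Formula

variable {V : Type v}

/-- The links of a proof structure with edges `E` labelled by formulas. An axiom link has two
conclusions and no premises, a cut link has two premises and no conclusions, a tensor or par link
has premises `a`, `b` and conclusion `c`, and a conclusion link has one premise. -/
inductive Link {E : Type} (lab : E → Formula V) : Type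
  | ax (e e' : E) (h : lab e' = (lab e).neg)
  | cut (e e' : E) (h : lab e' = (lab e).neg)
  | tensor (a b c : E) (h : lab c = .tensor (lab a) (lab b))
  | par (a b c : E) (h : lab c = .par (lab a) (lab b))
  | conc (e : E)

namespace Link
variable {E : Type} {lab : E → Formula V}

def premises : Link lab → List E
  | ax _ _ _ => []
  | cut e e' _ => [e, e']
  | tensor a b _ _ => [a, b]
  | par a b _ _ => [a, b]
  | conc e => [e]

def conclusions : Link lab → List E
  | ax e e' _ => [e, e']
  | cut _ _ _ => []
  | tensor _ _ c _ => [c]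
  | par _ _ c _ => [c]
  | conc _ => []

end Link

/-- A proof structure: a finite set of links and a finite set of edges, each of which is a
conclusion of exactly one link and a premise of exactly one link. The pending edges of the proof
structure are the premises of the conclusion links. -/
structure ProofStructure (V : Type v) where
  E : Type
  L : Type
  [fintypeE : Fintype E]
  [fintypeL : Fintype L]
  lab : E → Formula V
  link : L → Link lab
  nodup_premises : ∀ l, (link l).premises.Nodup
  existsUnique_conclusion : ∀ e, ∃! l, e ∈ (link l).conclusions
  existsUnique_premise : ∀ e, ∃! l, e ∈ (link l).premises

namespace ProofStructure

attribute [instance] fintypeE fintypeL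

variable (ζ : ProofStructure V)

/-- `ζ.Derivable Λ Γ` means that the links `Λ`, with pending edges `Γ`, arise by translating a proof
of the sequent `Γ` in the sequent calculus of multiplicative linear logic, that is, a proof built
from the axiom rule, the cut rule, the tensor rule and the par rule. -/
inductive Derivable : Set ζ.L → Set ζ.E → Prop
  | ax {l : ζ.L} {e e' : ζ.E} {h} (hl : ζ.link l = .ax e e' h) : Derivable {l} {e, e'}
  | cut {l : ζ.L} {e e' : ζ.E} {h} {Λ Λ' : Set ζ.L} {Γ Γ' : Set ζ.E}
      (hl : ζ.link l = .cut e e' h) (hΓ : Derivable Λ Γ) (hΓ' : Derivable Λ' Γ')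
      (he : e ∈ Γ) (he' : e' ∈ Γ') (hd : Disjoint Λ Λ') (hn : l ∉ Λ ∪ Λ') :
      Derivable (insert l (Λ ∪ Λ')) (Γ \ {e} ∪ Γ' \ {e'})
  | tensor {l : ζ.L} {a b c : ζ.E} {h} {Λ Λ' : Set ζ.L} {Γ Γ' : Set ζ.E}
      (hl : ζ.link l = .tensor a b c h) (hΓ : Derivable Λ Γ) (hΓ' : Derivable Λ' Γ')
      (ha : a ∈ Γ) (hb : b ∈ Γ') (hd : Disjoint Λ Λ') (hn : l ∉ Λ ∪ Λ') :
      Derivable (insert l (Λ ∪ Λ')) (insert c (Γ \ {a} ∪ Γ' \ {b}))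
  | par {l : ζ.L} {a b c : ζ.E} {h} {Λ : Set ζ.L} {Γ : Set ζ.E}
      (hl : ζ.link l = .par a b c h) (hΓ : Derivable Λ Γ) (ha : a ∈ Γ) (hb : b ∈ Γ)
      (hn : l ∉ Λ) : Derivable (insert l Λ) (insert c (Γ \ {a, b}))

/-- The pending edges `e_1, …, e_n`, labelled by the conclusions of the proof structure. -/
abbrev Conclusion : Type := {e : ζ.E // ∃ l, ζ.link l = .conc e}

instance : Fintype ζ.Conclusion := Fintype.ofFinite _

/-- The links other than the conclusion links. -/
def innerLinks : Set ζ.L := {l | ∀ e, ζ.link l ≠ .conc e}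

/-- A proof structure is a proof net if it is the translation of a proof. -/
def IsProofNet : Prop := ζ.Derivable ζ.innerLinks {e | ∃ l, ζ.link l = .conc e}

variable {ζ} in
lemma Derivable.exists_eval {Λ : Set ζ.L} {Γ : Set ζ.E} (h : ζ.Derivable Λ Γ) :
    ∃ e ∈ Γ, (ζ.lab e).eval = true := by
  induction h with
  | @ax l e e' h hl =>
    rcases hv : (ζ.lab e).eval
    · exact ⟨e', by simp, by rw [h, Formula.eval_neg, hv]; rfl⟩
    · exact ⟨e, by simp, hv⟩
  | @cut l e e' h Λ Λ' Γ Γ' hl hΓ hΓ' he he' hd hn ih ih' =>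
    obtain ⟨x, hx, hxv⟩ := ih
    obtain ⟨y, hy, hyv⟩ := ih'
    by_cases hxe : x = e
    · by_cases hye : y = e'
      · subst hxe hye
        rw [h, Formula.eval_neg, hxv] at hyv
        simp at hyv
      · exact ⟨y, .inr ⟨hy, hye⟩, hyv⟩
    · exact ⟨x, .inl ⟨hx, hxe⟩, hxv⟩
  | @tensor l a b c h Λ Λ' Γ Γ' hl hΓ hΓ' ha hb hd hn ih ih' =>
    obtain ⟨x, hx, hxv⟩ := ih
    obtain ⟨y, hy, hyv⟩ := ih'
    by_cases hxe : x = a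
    · by_cases hye : y = b
      · subst hxe hye
        exact ⟨c, .inl rfl, by rw [h, Formula.eval, hxv, hyv]; rfl⟩
      · exact ⟨y, .inr (.inr ⟨hy, hye⟩), hyv⟩
    · exact ⟨x, .inr (.inl ⟨hx, hxe⟩), hxv⟩
  | @par l a b c h Λ Γ hl hΓ ha hb hn ih =>
    obtain ⟨x, hx, hxv⟩ := ih
    by_cases hxe : x = a
    · subst hxe
      exact ⟨c, .inl rfl, by rw [h, Formula.eval, hxv]; rfl⟩
    · by_cases hxe' : x = b
      · subst hxe'
        exact ⟨c, .inl rfl, by rw [h, Formula.eval, hxv, Bool.or_true]⟩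
      · exact ⟨x, .inr ⟨hx, by simp [hxe, hxe']⟩, hxv⟩

end ProofStructure

/-- A proof net of multiplicative linear logic. -/
structure ProofNet (V : Type v) extends ProofStructure V where
  isProofNet : toProofStructure.IsProofNet

instance (ζ : ProofNet V) : Nonempty ζ.Conclusion :=
  let ⟨e, he, _⟩ := ζ.isProofNet.exists_eval
  ⟨⟨e, he⟩⟩

end Logic

section Geometry

variable (k : Type u) [Field k] {V : Type v}

/-- The projective space `ℙ^(2^m - 1)` of a formula `A`, where `m` is the number of atoms of `A`. -/
def Formula.space (A : Formula V) : Over (Spec (.of k)) := projectiveSpace k A.Coord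

/-- The identification of the projective spaces of `A` and `¬A`. -/
def Formula.spaceNeg (A : Formula V) : A.space k ⟶ A.neg.space k := relabel k A.negCoord

/-- The Segre embedding for a tensor product of formulas. -/
def Formula.segreTensor (A B : Formula V) : A.space k ⨯ B.space k ⟶ (tensor A B).space k :=
  segre (k := k) (ι := A.Coord) (κ := B.Coord)

/-- The Segre embedding for a par of formulas. -/
def Formula.segrePar (A B : Formula V) : A.space k ⨯ B.space k ⟶ (par A B).space k :=
  segre (k := k) (ι := A.Coord) (κ := B.Coord)

namespace Link
variable {E : Type} {lab : E → Formula V}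

/-- The product of the projective spaces of the premises and conclusions of a link. -/
def ambient : Link lab → Over (Spec (.of k))
  | ax e e' _ => (lab e).space k ⨯ (lab e').space k
  | cut e e' _ => (lab e).space k ⨯ (lab e').space k
  | tensor a b c _ => ((lab a).space k ⨯ (lab b).space k) ⨯ (lab c).space k
  | par a b c _ => ((lab a).space k ⨯ (lab b).space k) ⨯ (lab c).space k
  | conc e => (lab e).space k

/-- The scheme `X(l)` of a link `l`. -/
def scheme : Link lab → Over (Spec (.of k))
  | ax e _ _ => (lab e).space k
  | cut e _ _ => (lab e).space k
  | tensor a b _ _ => (lab a).space k ⨯ (lab b).space k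
  | par a b _ _ => (lab a).space k ⨯ (lab b).space k
  | conc e => (lab e).space k

/-- The inclusion of `X(l)` into the product of the projective spaces of the premises and
conclusions of `l`. It is the diagonal for axiom and cut links, the graph of the Segre embedding for
tensor and par links, and the identity for conclusion links. -/
def inclusion : (l : Link lab) → (l.scheme k ⟶ l.ambient k)
  | ax e _ h => prod.lift (𝟙 ((lab e).space k))
      ((lab e).spaceNeg k ≫ eqToHom (congrArg (Formula.space k) h.symm))
  | cut e _ h => prod.lift (𝟙 ((lab e).space k))
      ((lab e).spaceNeg k ≫ eqToHom (congrArg (Formula.space k) h.symm))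
  | tensor a b _ h => prod.lift (𝟙 ((lab a).space k ⨯ (lab b).space k))
      (Formula.segreTensor k (lab a) (lab b) ≫ eqToHom (congrArg (Formula.space k) h.symm))
  | par a b _ h => prod.lift (𝟙 ((lab a).space k ⨯ (lab b).space k))
      (Formula.segrePar k (lab a) (lab b) ≫ eqToHom (congrArg (Formula.space k) h.symm))
  | conc e => 𝟙 ((lab e).space k)

/-- The projection from the product of the projective spaces of all edges. -/
def projection [Finite E] : (l : Link lab) → ((∏ᶜ fun e ↦ (lab e).space k) ⟶ l.ambient k)
  | ax e e' _ => prod.lift (Pi.π _ e) (Pi.π _ e')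
  | cut e e' _ => prod.lift (Pi.π _ e) (Pi.π _ e')
  | tensor a b c _ => prod.lift (prod.lift (Pi.π _ a) (Pi.π _ b)) (Pi.π _ c)
  | par a b c _ => prod.lift (prod.lift (Pi.π _ a) (Pi.π _ b)) (Pi.π _ c)
  | conc e => Pi.π _ e

end Link

namespace ProofStructure
variable (ζ : ProofStructure V)

/-- The ambient scheme `S(ζ)`, the product of the projective spaces of all edges. -/
def ambient : Over (Spec (.of k)) := ∏ᶜ fun e ↦ (ζ.lab e).space k

/-- The closed subscheme of `S(ζ)` of the points whose components at the premises and
conclusions of `l` lie in `X(l)`. -/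
def linkSubscheme (l : ζ.L) : Over (Spec (.of k)) :=
  pullback ((ζ.link l).projection k) ((ζ.link l).inclusion k)

def linkSubschemeι (l : ζ.L) : ζ.linkSubscheme k l ⟶ ζ.ambient k := pullback.fst _ _

/-- The scheme `X(ζ)`, the intersection in `S(ζ)` of the subschemes of all links. -/
def scheme : Over (Spec (.of k)) :=
  widePullback (ζ.ambient k) (ζ.linkSubscheme k) (ζ.linkSubschemeι k)

/-- The inclusion `X(ζ) ⟶ S(ζ)`. -/
def inclusion : ζ.scheme k ⟶ ζ.ambient k := WidePullback.base _

/-- The product of the projective spaces of the conclusions. -/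
def conclusionSpace : Over (Spec (.of k)) :=
  ∏ᶜ fun j : ζ.Conclusion ↦ projectiveSpace k (ζ.lab j.1).Coord

/-- The projection from `S(ζ)` to the product of the projective spaces of the conclusions. -/
def toConclusionSpace : ζ.ambient k ⟶ ζ.conclusionSpace k :=
  Pi.lift fun j : ζ.Conclusion ↦ Pi.π (fun e ↦ (ζ.lab e).space k) j.1

end ProofStructure

/-- A homogeneous ideal `I` is saturated if it contains every `x` such that `x (A_+)^n ⊆ I` for some
`n`. -/
def IsSaturated {k : Type u} [Field k] {A : Type u} [CommRing A] [Algebra k A] {𝒜 : ℕ → Submodule k A} [GradedAlgebra 𝒜]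
    (I : HomogeneousIdeal 𝒜) : Prop :=
  ∀ x : A, (∃ n : ℕ, ∀ y ∈ (HomogeneousIdeal.irrelevant 𝒜).toIdeal ^ n, x * y ∈ I) → x ∈ I

/-- The grading of the Cartesian product of the homogeneous coordinate rings of the projective
spaces of the conclusions. -/
abbrev ProofNet.coordinatePiece (ζ : ProofNet V) :
    ℕ → Submodule k (Cartesian k fun j : ζ.Conclusion ↦ (ζ.lab j.1).Coord) :=
  cartesianPiece k fun j : ζ.Conclusion ↦ (ζ.lab j.1).Coord

/-- The closed subscheme `Proj (S / I)` of `Proj S` is `X(ζ)`, where `S` is the Cartesian product of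
the homogeneous coordinate rings of the conclusions. -/
def ProofNet.CutsOut (ζ : ProofNet V) (I : HomogeneousIdeal (ζ.coordinatePiece k)) : Prop :=
  ∃ φ : (ζ.scheme k).left ≅ Proj (quotientPiece I), φ.hom ≫ projQuotientι I =
    (ζ.inclusion k ≫ ζ.toConclusionSpace k).left ≫
      prodToProj fun j : ζ.Conclusion ↦ (ζ.lab j.1).Coord

/-- A module `M` is locally free of rank `r` if there are `f_1, …, f_n` generating the unit ideal
of `R` such that `M_{f_i}` is a free `R_{f_i}`-module of rank `r` for all `i`. -/
def IsLocallyFreeOfRank (R : Type u) (M : Type w) [CommRing R] [AddCommGroup M] [Module R M]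
    (r : ℕ) : Prop :=
  ∃ s : Finset R, Ideal.span (s : Set R) = ⊤ ∧ ∀ f ∈ s,
    Nonempty (Module.Basis (Fin r) (Localization.Away f) (LocalizedModule (.powers f) M))

end Geometry

end LL

end

open CategoryTheory AlgebraicGeometry LL

/-!
The morphism from `X(ζ)` to the product of the projective spaces of the conclusions is a closed
immersion because it is a proper monomorphism. It is proper because `X(ζ)` is a finite limit of
products of projective spaces, which are proper over `k`, and the product of the projective spaces
of the conclusions is separated over `k`.

That it is a monomorphism is a statement about `T`-valued points for every `k`-scheme `T`. A
`T`-valued point of `X(ζ)` is a family of `T`-valued points of the projective spaces of the edges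
that satisfies the condition imposed by each link: dual edges of axiom and cut links carry
corresponding points, and the conclusion of a tensor or par link carries the Segre product of the
points of its premises. The Segre embeddings are injective on `T`-valued points
(`segreHom_injective`), so tensor and par behave as pairings (`PointModel`), and the relation of
strict coherence known from coherence spaces can be defined on the points of each formula
(`PointModel.StrictCoh`). Two distinct points are strictly coherent for exactly one of `A` and
`¬A`. By induction on a derivation, two families of points satisfying all link conditions agree on
all edges or are strictly coherent at some pending edge (`PointModel.eq_or_strictCoh`). Strictly
coherent points are distinct, so families that agree at the conclusions of a proof net are equal.

The same reasoning shows that the morphism `τ` from a product of projective spaces to `Proj` of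
the Cartesian product `S` of their coordinate rings is a closed immersion
(`isClosedImmersion_prodToProj`), since the coordinates of the factors are recovered from the
products of coordinates. Hence `X(ζ)` is a closed subscheme of `Proj S`.

The irrelevant ideal of `S` is generated by finitely many elements `f_c` of degree one, the
products of variables with one variable from each factor (`irrelevant_le_span_boxMonomial`). For a
graded ring with this property, a closed subscheme with ideal sheaf `K` is cut out by the
homogeneous ideal of the `x` such that all functions `x / f_c ^ n`, where `n` is the degree of
`x`, lie in `K`. This ideal is saturated, and saturated ideals with the same closed subscheme
coincide (`existsUnique_isSaturated`). Finally, the graded pieces of `S`, hence those of `S / I`,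
are finite-dimensional over `k`, because there are finitely many monomials of bounded degree.
-/

noncomputable section

namespace LL

open CategoryTheory Limits AlgebraicGeometry MvPolynomial HomogeneousLocalization

attribute [local instance] MvPolynomial.gradedAlgebra

/-! ### Properness of finite products and of projective spaces -/

section Proper

/-- Proper morphisms satisfy the cancellation property that makes the schemes that are proper over a
base closed under finite limits. -/
instance isProper_hasOfPostcompProperty : MorphismProperty.HasOfPostcompProperty
    (@IsProper : MorphismProperty Scheme.{u}) (@IsProper : MorphismProperty Scheme.{u}) :=
  MorphismProperty.HasOfPostcompProperty.of_le (W := @IsProper) (Q := @IsSeparated)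
    (by intro _ _ _ h; exact h.toIsSeparated)

lemma isProper_limit {S : Scheme.{u}} {J : Type w} [SmallCategory J] [FinCategory J]
    (F : J ⥤ Over S) (h : ∀ j, IsProper (F.obj j).hom) : IsProper (limit F).hom := by
  let P : MorphismProperty Scheme.{u} := @IsProper
  let G : J ⥤ MorphismProperty.Over P ⊤ S :=
    MorphismProperty.Comma.lift F h (fun _ ↦ trivial) (fun _ ↦ trivial)
  let e : (MorphismProperty.Over.forget P ⊤ S).obj (limit G) ≅ limit F :=
    preservesLimitIso (MorphismProperty.Over.forget P ⊤ S) G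
  have h1 : IsProper ((MorphismProperty.Over.forget P ⊤ S).obj (limit G)).hom := (limit G).prop
  have : (limit F).hom = e.inv.left ≫ ((MorphismProperty.Over.forget P ⊤ S).obj (limit G)).hom :=
    (Over.w e.inv).symm
  have : IsIso e.inv.left := inferInstanceAs (IsIso ((Over.forget S).map e.inv))
  rw [‹(limit F).hom = _›]
  exact (MorphismProperty.cancel_left_of_respectsIso (@IsProper : MorphismProperty Scheme.{u})
    e.inv.left _).mpr h1

variable {k : Type u} [Field k]

lemma isProper_projStr {A : Type u} [CommRing A] [Algebra k A] [Algebra.FiniteType k A]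
    (𝒜 : ℕ → Submodule k A) [GradedAlgebra 𝒜] [Module.Finite k (𝒜 0)] : IsProper (projStr 𝒜) := by
  have : IsScalarTower k (𝒜 0) A := ⟨fun c x y ↦ smul_mul_assoc c (x : A) y⟩
  have : Algebra.FiniteType (𝒜 0) A := .of_restrictScalars_finiteType k _ _
  unfold projStr
  have : IsFinite (Spec.map (CommRingCat.ofHom (algebraMap k (𝒜 0)))) := by
    rw [IsFinite.SpecMap_iff]
    exact RingHom.finite_algebraMap.mpr inferInstance
  infer_instance

lemma isSeparated_projStr {A : Type u} [CommRing A] [Algebra k A] (𝒜 : ℕ → Submodule k A)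
    [GradedAlgebra 𝒜] : IsSeparated (projStr 𝒜) := by
  unfold projStr
  infer_instance

lemma finite_weightedHomogeneousSubmodule {σ M : Type*} [AddCommMonoid M] (w : σ → M) (m : M)
    (h : {d : σ →₀ ℕ | Finsupp.weight w d = m}.Finite) :
    Module.Finite k (weightedHomogeneousSubmodule k w m) := by
  have := h.to_subtype
  refine Module.Finite.of_injective (LinearMap.pi fun d : {d : σ →₀ ℕ | Finsupp.weight w d = m} ↦
    lcoeff k d.1 ∘ₗ (weightedHomogeneousSubmodule k w m).subtype) fun p q hpq ↦ ?_
  ext d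
  by_cases hd : Finsupp.weight w d = m
  · exact congrFun hpq ⟨d, hd⟩
  · rw [p.2.coeff_eq_zero d hd, q.2.coeff_eq_zero d hd]

instance finite_homogeneousSubmodule {ι : Type*} [Finite ι] (d : ℕ) :
    Module.Finite k (homogeneousSubmodule ι k d) := by
  refine finite_weightedHomogeneousSubmodule _ _ ((Finsupp.finite_of_degree_le d).subset ?_)
  intro x hx
  simp at hx
  simp [Finsupp.degree_eq_weight_one]
  exact hx.le

lemma isProper_projectiveSpace (ι : Type) [Finite ι] : IsProper (projectiveSpace k ι).hom :=
  isProper_projStr _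

end Proper

/-! ### Morphisms to `Proj` given by ring homomorphisms -/

section
variable {k : Type u} [Field k] {A : Type u} [CommRing A] [Algebra k A]
  (𝒜 : ℕ → Submodule k A) [GradedAlgebra 𝒜] {Y : Scheme.{u}}

lemma chart_congr {φ ψ : A →+* Γ(Y, ⊤)} (h : φ = ψ) (f : A) {m : ℕ} (hf : f ∈ 𝒜 m) (hm : 0 < m)
    (hu : IsUnit (φ f)) (hu' : IsUnit (ψ f)) :
    chart 𝒜 φ f hf hm hu = chart 𝒜 ψ f hf hm hu' := by
  subst h; rfl

lemma toSpecΓ_SpecMap_injective {R : Type u} [CommRing R] {α β : R →+* Γ(Y, ⊤)}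
    (h : Y.toSpecΓ ≫ Spec.map (CommRingCat.ofHom α) = Y.toSpecΓ ≫ Spec.map (CommRingCat.ofHom β)) :
    α = β := by
  have := congrArg Scheme.Hom.appTop h
  simp only [Scheme.Hom.comp_appTop, Scheme.toSpecΓ_appTop] at this
  erw [Scheme.ΓSpecIso_naturality, Scheme.ΓSpecIso_naturality] at this
  exact congrArg CommRingCat.Hom.hom ((cancel_epi _).mp this)

/-- The values of a ring homomorphism at homogeneous elements are determined, up to the factor that
compares the values at `f`, by the morphism to `Proj` that it defines. -/
lemma chart_injective {φ ψ : A →+* Γ(Y, ⊤)} {f : A} {m : ℕ} {hf : f ∈ 𝒜 m} {hm : 0 < m}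
    {hu : IsUnit (φ f)} {hu' : IsUnit (ψ f)}
    (h : chart 𝒜 φ f hf hm hu = chart 𝒜 ψ f hf hm hu') (n : ℕ) (x : A) (hx : x ∈ 𝒜 (n • m)) :
    φ x * ψ f ^ n = ψ x * φ f ^ n := by
  rw [chart, chart, ← Category.assoc, ← Category.assoc, cancel_mono] at h
  have := toSpecΓ_SpecMap_injective h
  rw [← awayLift_mk_mul 𝒜 hf φ hu n x hx, ← awayLift_mk_mul 𝒜 hf ψ hu' n x hx, this]
  ring

lemma chart_preimage_basicOpen (φ : A →+* Γ(Y, ⊤)) {f : A} {m : ℕ} (hf : f ∈ 𝒜 m) (hm : 0 < m)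
    (hu : IsUnit (φ f)) {g : A} {m' : ℕ} (hg : g ∈ 𝒜 m') (hm' : 0 < m') :
    chart 𝒜 φ f hf hm hu ⁻¹ᵁ Proj.basicOpen 𝒜 g = Y.basicOpen (φ g) := by
  rw [chart, Scheme.Hom.comp_preimage, Scheme.Hom.comp_preimage,
    Proj.awayι_preimage_basicOpen 𝒜 hf hm hg hm']
  -- The function `φ (g ^ m / f ^ m')` differs from `φ g ^ m` by a unit.
  have h := awayLift_mk_mul 𝒜 hf φ hu m' (g ^ m) (by
    convert! SetLike.pow_mem_graded m hg using 2; exact mul_comm _ _)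
  have hb : Y.basicOpen (awayLift 𝒜 f φ hu (Away.isLocalizationElem hf hg)) =
      Y.basicOpen (φ g) := by
    have h' := congrArg Y.basicOpen h
    rwa [Scheme.basicOpen_mul, Y.basicOpen_of_isUnit (hu.pow m'), map_pow,
      Scheme.basicOpen_pow _ _ hm, inf_top_eq] at h'
  rw [← hb]
  exact Scheme.toSpecΓ_preimage_basicOpen Y _

lemma appLE_comp_ι {W : Scheme.{u}} (U : W.Opens) (l : Y ⟶ U) (h : ⊤ ≤ (l ≫ U.ι) ⁻¹ᵁ U) :
    (l ≫ U.ι).appLE U ⊤ h = U.topIso.inv ≫ l.appTop := by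
  have h1 : l.appLE ⊤ ⊤ le_top = l.appTop := by
    simp only [Scheme.Hom.appLE, Scheme.Hom.appTop]
    exact (congrArg (l.app ⊤ ≫ ·) (Y.presheaf.map_id _)).trans (Category.comp_id _)
  rw [← Scheme.Hom.appLE_comp_appLE l U.ι U ⊤ ⊤ (by simp) le_top, h1]
  congr 1
  simp only [Scheme.Hom.appLE, Scheme.Opens.ι_app, Scheme.Opens.toScheme_presheaf_map,
    Scheme.Opens.topIso_inv]
  exact (W.presheaf.map_comp _ _).symm

/-- A morphism to the open subset `f ≠ 0` of `Proj 𝒜` is determined by the pullback of functions. -/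
lemma eq_toSpecΓ_awayι (g : Y ⟶ Proj 𝒜) {f : A} {m : ℕ} (hf : f ∈ 𝒜 m) (hm : 0 < m)
    (h : ⊤ ≤ g ⁻¹ᵁ Proj.basicOpen 𝒜 f) :
    g = Y.toSpecΓ ≫ Spec.map (Proj.awayToSection 𝒜 f ≫ g.appLE (Proj.basicOpen 𝒜 f) ⊤ h) ≫
      Proj.awayι 𝒜 f hf hm := by
  let U : (Proj 𝒜).Opens := Proj.basicOpen 𝒜 f
  let l : Y ⟶ U := IsOpenImmersion.lift U.ι g (by
    rintro _ ⟨y, rfl⟩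
    rw [Scheme.Opens.range_ι]
    exact h (x := y) trivial)
  have hl : l ≫ U.ι = g := IsOpenImmersion.lift_fac _ _ _
  have h1 : g.appLE U ⊤ h = U.topIso.inv ≫ l.appTop := by
    rw [← appLE_comp_ι U l (by rw [hl]; exact h)]
    simp only [hl]
  have h2 : Y.toSpecΓ ≫ Spec.map (Proj.awayToSection 𝒜 f ≫ g.appLE U ⊤ h) =
      l ≫ (Proj.basicOpenIsoSpec 𝒜 f hf hm).hom := by
    rw [h1, Proj.basicOpenIsoSpec_hom, Proj.basicOpenToSpec]
    rw [Spec.map_comp, Spec.map_comp, Category.assoc, ← Scheme.toSpecΓ_naturality_assoc]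
    simp only [Scheme.Opens.toSpecΓ, Category.assoc]
    rfl
  rw [reassoc_of% h2, ← Proj.basicOpenIsoSpec_inv_ι, Iso.hom_inv_id_assoc, hl]

lemma chart_map {B : Type u} [CommRing B] [Algebra k B] (ℬ : ℕ → Submodule k B) [GradedAlgebra ℬ]
    (F : 𝒜 →+*ᵍ ℬ) (hF : HomogeneousIdeal.irrelevant ℬ ≤ (HomogeneousIdeal.irrelevant 𝒜).map F)
    (φ : B →+* Γ(Y, ⊤)) {f : A} {m : ℕ} (hf : f ∈ 𝒜 m) (hm : 0 < m)
    (hu : IsUnit (φ (F f))) :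
    chart ℬ φ (F f) (F.2 hf) hm hu ≫ Proj.map F hF = chart 𝒜 (φ.comp F.toRingHom) f hf hm hu := by
  have h : (awayLift ℬ (F f) φ hu).comp (Away.map F f) =
      awayLift 𝒜 f (φ.comp F.toRingHom) hu := by
    refine awayLift_eq 𝒜 hf _ _ _ fun n x hx ↦ ?_
    rw [RingHom.comp_apply, Away.map_mk]
    exact awayLift_mk_mul ℬ (F.2 hf) φ hu n (F x) (F.2 hx)
  rw [chart, chart, Category.assoc, Category.assoc, Proj.awayι_comp_map F hF hm f hf, ← h,
    CommRingCat.ofHom_comp, Spec.map_comp, Category.assoc]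

end

/-! ### Homogeneous coordinates of morphisms to projective spaces -/

section Coordinates
variable {k : Type u} [Field k] {ι : Type} {Y : Scheme.{u}}

/-- Substitution of `v a` for the variable `x_a`, over the structure morphism `p`. -/
abbrev evalHom {σ : Type} (p : Y ⟶ Spec (.of k)) (v : σ → Γ(Y, ⊤)) : MvPolynomial σ k →+* Γ(Y, ⊤) :=
  eval₂Hom (scalars p) v

lemma evalHom_scalars {σ : Type} (p : Y ⟶ Spec (.of k)) (v : σ → Γ(Y, ⊤)) :
    (evalHom p v).comp (algebraMap k _) = scalars p := by
  ext x; simp [algebraMap_eq]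

lemma comp_evalHom {σ : Type} {Z : Scheme.{u}} (f : Z ⟶ Y) (p : Y ⟶ Spec (.of k))
    (v : σ → Γ(Y, ⊤)) :
    f.appTop.hom.comp (evalHom p v) = evalHom (f ≫ p) (fun a ↦ f.appTop.hom (v a)) := by
  ext x
  · simp [← scalars_comp]
  · simp

/-- The morphism to the open subset `x_i ≠ 0` of projective space with coordinates `v`. -/
def ofCoords (p : Y ⟶ Spec (.of k)) (v : ι → Γ(Y, ⊤)) (i : ι) (hv : IsUnit (v i)) :
    Y ⟶ Proj (homogeneousSubmodule ι k) :=
  chart _ (evalHom p v) (X i) (X_mem i) one_pos (by simpa using hv)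

lemma ofCoords_congr {p q : Y ⟶ Spec (.of k)} (h : p = q) {v w : ι → Γ(Y, ⊤)} (e : v = w) (i : ι)
    (hv : IsUnit (v i)) (hw : IsUnit (w i)) : ofCoords p v i hv = ofCoords q w i hw := by
  subst h e; rfl

lemma ofCoords_injective {p : Y ⟶ Spec (.of k)} {v w : ι → Γ(Y, ⊤)} {i : ι} {hv : IsUnit (v i)}
    {hw : IsUnit (w i)} (h : ofCoords p v i hv = ofCoords p w i hw) (a : ι) :
    v a * w i = w a * v i := by
  have := chart_injective _ h 1 (X a) (X_mem a)
  simpa using this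

lemma ofCoords_preimage (p : Y ⟶ Spec (.of k)) (v : ι → Γ(Y, ⊤)) (i : ι) (hv : IsUnit (v i))
    (a : ι) : ofCoords p v i hv ⁻¹ᵁ stdOpen a = Y.basicOpen (v a) := by
  rw [ofCoords, chart_preimage_basicOpen _ _ _ _ _ (X_mem a) one_pos]
  simp

lemma comp_ofCoords {Z : Scheme.{u}} (f : Z ⟶ Y) (p : Y ⟶ Spec (.of k)) (v : ι → Γ(Y, ⊤)) (i : ι)
    (hv : IsUnit (v i)) : f ≫ ofCoords p v i hv =
      ofCoords (f ≫ p) (fun a ↦ f.appTop.hom (v a)) i (hv.map f.appTop.hom) := by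
  rw [ofCoords, comp_chart]
  exact chart_congr _ (comp_evalHom f p v) _ _ _ _ _

/-- The substitution of `x_a / x_i` for `x_a`. It maps a homogeneous polynomial `x` of degree `n` to
`x / x_i ^ n`, see `dehomogenize_of_mem`. -/
def dehomogenize (i : ι) : MvPolynomial ι k →+* Away (homogeneousSubmodule ι k) (X i) :=
  eval₂Hom ((fromZeroRingHom _ _).comp (algebraMap k (homogeneousSubmodule ι k 0)))
    fun a ↦ Away.mk _ (X_mem i) 1 (X a) (X_mem a)

lemma dehomogenize_of_mem (i : ι) (n : ℕ) (x : MvPolynomial ι k)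
    (hx : x ∈ homogeneousSubmodule ι k (n • 1)) :
    dehomogenize i x = Away.mk _ (X_mem i) n x hx := by
  let L := Localization.Away (X i : MvPolynomial ι k)
  let θ := algebraMap (MvPolynomial ι k) L
  let α := algebraMap (Away (homogeneousSubmodule ι k) (X i)) L
  have hz (a : ι) : θ (X a) = θ (X i) * α (dehomogenize i (X a)) := by
    rw [dehomogenize, coe_eval₂Hom, eval₂_X, HomogeneousLocalization.algebraMap_apply, Away.val_mk,
      Localization.mk_eq_mk', mul_comm]
    have := IsLocalization.mk'_spec L (X a) (⟨X i ^ 1, 1, rfl⟩ :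
      Submonoid.powers (X i : MvPolynomial ι k))
    refine Eq.trans this.symm ?_
    congr 2
    exact pow_one _
  have hc (c : k) : θ (C c) = α (dehomogenize i (C c)) := by
    rw [dehomogenize, coe_eval₂Hom, eval₂_C]
    exact (Localization.mk_one_eq_algebraMap (M := Submonoid.powers (X i)) (C c)).symm
  have h1 (p : MvPolynomial ι k) : θ p = eval₂ (θ.comp C) (fun a ↦ θ (X a)) p :=
    congrArg (fun f : MvPolynomial ι k →+* L ↦ f p) (by ext <;> simp :
      θ = eval₂Hom (θ.comp C) fun a ↦ θ (X a))
  have h2 (p : MvPolynomial ι k) : α (dehomogenize i p) =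
      eval₂ (θ.comp C) (fun a ↦ α (dehomogenize i (X a))) p :=
    congrArg (fun f : MvPolynomial ι k →+* L ↦ f p) (by
      ext
      · simp [hc]
      · simp : α.comp (dehomogenize i) =
      eval₂Hom (θ.comp C) fun a ↦ α (dehomogenize i (X a)))
  have h3 := eval₂_scale (M := ℕ) 1 (powersHom L (θ (X i))) (θ.comp C) _ _ (fun a ↦ by
    simpa using hz a) x n (by rwa [nsmul_one, Nat.cast_id] at hx)
  rw [← h1, ← h2] at h3
  refine HomogeneousLocalization.val_injective _ ?_
  rw [Away.val_mk, Localization.mk_eq_mk', IsLocalization.eq_mk'_iff_mul_eq]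
  change α _ * θ (X i ^ n) = θ x
  rw [h3, map_pow, mul_comm]
  simp

/-- A morphism with image in `x_i ≠ 0` is determined by its coordinates. -/
lemma eq_ofCoords (g : Y ⟶ Proj (homogeneousSubmodule ι k)) (i : ι) (h : ⊤ ≤ g ⁻¹ᵁ stdOpen i) :
    g = ofCoords (g ≫ projStr _) (coord g i h) i (by rw [coord_self]; exact isUnit_one) := by
  let χ : Away (homogeneousSubmodule ι k) (X i) →+* Γ(Y, ⊤) :=
    (Proj.awayToSection (homogeneousSubmodule ι k) (X i) ≫ g.appLE (stdOpen i) ⊤ h).hom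
  have hχ : g = Y.toSpecΓ ≫ Spec.map (CommRingCat.ofHom χ) ≫
      Proj.awayι (homogeneousSubmodule ι k) (X i) (X_mem i) one_pos :=
    eq_toSpecΓ_awayι _ g (X_mem i) one_pos h
  have hs : χ.comp ((fromZeroRingHom _ _).comp (algebraMap k (homogeneousSubmodule ι k 0))) =
      scalars (g ≫ projStr _) := by
    apply toSpecΓ_SpecMap_injective
    rw [toSpecΓ_scalars]
    conv_rhs => rw [hχ]
    rw [projStr, Category.assoc, Category.assoc, Proj.awayι_toSpecZero_assoc, ← Spec.map_comp,
      ← Spec.map_comp]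
    rfl
  have hd : evalHom (g ≫ projStr _) (coord g i h) = χ.comp (dehomogenize i) := by
    ext c
    · simp [dehomogenize, ← hs]
    · simp [dehomogenize]
      rfl
  have hw : awayLift (homogeneousSubmodule ι k) (X i) (evalHom (g ≫ projStr _) (coord g i h))
      (by simp [coord_self]) = χ := by
    refine (awayLift_eq _ (X_mem i) _ _ _ fun n x hx ↦ ?_).symm
    rw [hd, RingHom.comp_apply, RingHom.comp_apply, dehomogenize_of_mem i n x hx,
      dehomogenize_of_mem i 1 (X i) (X_mem i)]
    have h1 : χ (Away.mk (homogeneousSubmodule ι k) (X_mem i) 1 (X i) (X_mem i)) = 1 :=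
      coord_self g i h
    rw [h1, one_pow, mul_one]
  rw [ofCoords, chart, hw]
  exact hχ

end Coordinates

section
variable {k : Type u} [Field k] {ι κ : Type} {Y : Scheme.{u}}

lemma chart_congr_elem {A : Type u} [CommRing A] [Algebra k A]
    (𝒜 : ℕ → Submodule k A) [GradedAlgebra 𝒜] (φ : A →+* Γ(Y, ⊤)) {f g : A} (h : f = g) {m : ℕ}
    (hf : f ∈ 𝒜 m) (hg : g ∈ 𝒜 m) (hm : 0 < m) (hu : IsUnit (φ f)) (hu' : IsUnit (φ g)) :
    chart 𝒜 φ f hf hm hu = chart 𝒜 φ g hg hm hu' := by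
  subst h; rfl

lemma hom_ext_of_opens {W : Scheme.{u}} {g g' : Y ⟶ W}
    (h : ∀ y : Y, ∃ U : Y.Opens, y ∈ U ∧ U.ι ≫ g = U.ι ≫ g') : g = g' := by
  choose U hy hU using h
  have hc : TopologicalSpace.IsOpenCover U := TopologicalSpace.IsOpenCover.mk (top_unique fun y _ ↦
    TopologicalSpace.Opens.mem_iSup.mpr ⟨y, hy y⟩)
  exact (Y.openCoverOfIsOpenCover U hc).hom_ext _ _ fun y ↦ hU y

lemma basicOpen_coord (g : Y ⟶ Proj (homogeneousSubmodule ι k)) (i : ι) (h : ⊤ ≤ g ⁻¹ᵁ stdOpen i)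
    (a : ι) : Y.basicOpen (coord g i h a) = g ⁻¹ᵁ stdOpen a := by
  conv_rhs => rw [eq_ofCoords g i h]
  rw [ofCoords_preimage]

lemma coord_ofCoords (p : Y ⟶ Spec (.of k)) (v : ι → Γ(Y, ⊤)) (i : ι) (hv : IsUnit (v i))
    (h : ⊤ ≤ ofCoords p v i hv ⁻¹ᵁ stdOpen i) (a : ι) :
    coord (ofCoords p v i hv) i h a * v i = v a := by
  have hp : ofCoords p v i hv ≫ projStr _ = p := chart_projStr _ _ _ (evalHom_scalars p v) _ _ _ _
  have e := eq_ofCoords (ofCoords p v i hv) i h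
  rw [ofCoords_congr hp rfl i _ (by rw [coord_self]; exact isUnit_one)] at e
  have := ofCoords_injective e a
  rw [coord_self, mul_one] at this
  exact this.symm

/-- Over `k`, morphisms to projective space agree if they have the same coordinates locally. -/
lemma hom_ext_of_coord {g g' : Y ⟶ Proj (homogeneousSubmodule ι k)}
    (hp : g ≫ projStr _ = g' ≫ projStr _)
    (h : ∀ y : Y, ∃ (U : Y.Opens) (i : ι) (h : ⊤ ≤ (U.ι ≫ g) ⁻¹ᵁ stdOpen i)
      (h' : ⊤ ≤ (U.ι ≫ g') ⁻¹ᵁ stdOpen i), y ∈ U ∧ ∀ a, coord _ i h a = coord _ i h' a) :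
    g = g' := by
  refine hom_ext_of_opens fun y ↦ ?_
  obtain ⟨U, i, h, h', hy, e⟩ := h y
  refine ⟨U, hy, ?_⟩
  rw [eq_ofCoords _ i h, eq_ofCoords _ i h']
  exact ofCoords_congr (by simp only [Category.assoc, hp]) (funext e) _ _ _

/-! ### The Segre embedding on points -/

section Segre
variable (p : Y ⟶ Spec (.of k)) (g : Y ⟶ Proj (homogeneousSubmodule ι k))
  (g' : Y ⟶ Proj (homogeneousSubmodule κ k))

lemma comp_segreHom_eq_ofCoords {W : Scheme.{u}} (f : W ⟶ Y) (c : ι × κ)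
    (h : ⊤ ≤ (f ≫ g) ⁻¹ᵁ stdOpen c.1) (h' : ⊤ ≤ (f ≫ g') ⁻¹ᵁ stdOpen c.2) :
    f ≫ segreHom p g g' = ofCoords (f ≫ p)
      (fun a ↦ coord (f ≫ g) c.1 h a.1 * coord (f ≫ g') c.2 h' a.2) c
      (by rw [coord_self, coord_self, one_mul]; exact isUnit_one) := by
  let U : Y.Opens := g ⁻¹ᵁ stdOpen c.1 ⊓ g' ⁻¹ᵁ stdOpen c.2
  obtain ⟨l, rfl⟩ : ∃ l : W ⟶ U, l ≫ U.ι = f := ⟨IsOpenImmersion.lift U.ι f (by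
    rintro _ ⟨y, rfl⟩
    rw [Scheme.Opens.range_ι]
    exact ⟨h (x := y) trivial, h' (x := y) trivial⟩), IsOpenImmersion.lift_fac _ _ _⟩
  have e : U.ι ≫ segreHom p g g' = ofCoords (U.ι ≫ p)
      (fun a ↦ coord (U.ι ≫ g) c.1 (top_le_preimage_ι _ _ _ inf_le_left) a.1 *
        coord (U.ι ≫ g') c.2 (top_le_preimage_ι _ _ _ inf_le_right) a.2) c
      (by rw [coord_self, coord_self, one_mul]; exact isUnit_one) :=
    ι_glueCharts _ _ _ _ _ _ _ _ _ _ c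
  rw [Category.assoc, e, comp_ofCoords]
  refine ofCoords_congr (by simp) (funext fun a ↦ ?_) _ _ _
  rw [map_mul, comp_coord l _ _ _ (by rw [← Category.assoc]; exact h),
    comp_coord l _ _ _ (by rw [← Category.assoc]; exact h')]
  simp only [Category.assoc]

/-- Locally, some coordinate of `g` and some coordinate of `g'` do not vanish. -/
lemma exists_segre_box (y : Y) : ∃ (U : Y.Opens) (c : ι × κ), y ∈ U ∧
    ⊤ ≤ (U.ι ≫ g) ⁻¹ᵁ stdOpen c.1 ∧ ⊤ ≤ (U.ι ≫ g') ⁻¹ᵁ stdOpen c.2 := by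
  obtain ⟨i, hi⟩ := isOpenCover_stdOpen.exists_mem (g y)
  obtain ⟨j, hj⟩ := isOpenCover_stdOpen.exists_mem (g' y)
  exact ⟨g ⁻¹ᵁ stdOpen i ⊓ g' ⁻¹ᵁ stdOpen j, (i, j), ⟨hi, hj⟩,
    top_le_preimage_ι _ _ _ inf_le_left, top_le_preimage_ι _ _ _ inf_le_right⟩

lemma comp_segreHom {W : Scheme.{u}} (f : W ⟶ Y) :
    f ≫ segreHom p g g' = segreHom (f ≫ p) (f ≫ g) (f ≫ g') := by
  refine hom_ext_of_opens fun y ↦ ?_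
  obtain ⟨U, c, hy, h, h'⟩ := exists_segre_box (f ≫ g) (f ≫ g') y
  refine ⟨U, hy, ?_⟩
  rw [← Category.assoc, comp_segreHom_eq_ofCoords p g g' (U.ι ≫ f) c (by simpa using h)
    (by simpa using h'), comp_segreHom_eq_ofCoords _ _ _ U.ι c h h']
  simp only [Category.assoc]

lemma segreHom_preimage (c : ι × κ) :
    segreHom p g g' ⁻¹ᵁ stdOpen c = g ⁻¹ᵁ stdOpen c.1 ⊓ g' ⁻¹ᵁ stdOpen c.2 := by
  ext y
  obtain ⟨U, d, hy, h, h'⟩ := exists_segre_box g g' y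
  have e := comp_segreHom_eq_ofCoords p g g' U.ι d h h'
  have e' := congrArg (fun f ↦ f ⁻¹ᵁ stdOpen c) e
  simp only [ofCoords_preimage, Scheme.basicOpen_mul, basicOpen_coord] at e'
  have := congrArg (fun V : U.toScheme.Opens ↦ (⟨y, hy⟩ : U) ∈ V) e'
  exact this.to_iff

variable {p g g'} in
/-- The Segre embedding is injective on points with values in a `k`-scheme. -/
lemma segreHom_injective {f : Y ⟶ Proj (homogeneousSubmodule ι k)}
    {f' : Y ⟶ Proj (homogeneousSubmodule κ k)} (hg : g ≫ projStr _ = p) (hg' : g' ≫ projStr _ = p)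
    (hf : f ≫ projStr _ = p) (hf' : f' ≫ projStr _ = p) (h : segreHom p g g' = segreHom p f f') :
    g = f ∧ g' = f' := by
  have key (y : Y) : ∃ (U : Y.Opens) (c : ι × κ) (h1 : ⊤ ≤ (U.ι ≫ g) ⁻¹ᵁ stdOpen c.1)
      (h1' : ⊤ ≤ (U.ι ≫ g') ⁻¹ᵁ stdOpen c.2) (h2 : ⊤ ≤ (U.ι ≫ f) ⁻¹ᵁ stdOpen c.1)
      (h2' : ⊤ ≤ (U.ι ≫ f') ⁻¹ᵁ stdOpen c.2), y ∈ U ∧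
      ∀ a : ι × κ, coord _ c.1 h1 a.1 * coord _ c.2 h1' a.2 =
        coord _ c.1 h2 a.1 * coord _ c.2 h2' a.2 := by
    obtain ⟨U, c, hy, h1, h1'⟩ := exists_segre_box g g' y
    have hU : ⊤ ≤ (U.ι ≫ segreHom p f f') ⁻¹ᵁ stdOpen c := by
      rw [← h, Scheme.Hom.comp_preimage, segreHom_preimage]
      exact le_inf h1 h1'
    rw [Scheme.Hom.comp_preimage, segreHom_preimage] at hU
    have h2 : ⊤ ≤ (U.ι ≫ f) ⁻¹ᵁ stdOpen c.1 := fun x hx ↦ (hU hx).1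
    have h2' : ⊤ ≤ (U.ι ≫ f') ⁻¹ᵁ stdOpen c.2 := fun x hx ↦ (hU hx).2
    refine ⟨U, c, h1, h1', h2, h2', hy, fun a ↦ ?_⟩
    have e := congrArg (U.ι ≫ ·) h
    rw [comp_segreHom_eq_ofCoords _ _ _ _ c h1 h1',
      comp_segreHom_eq_ofCoords _ _ _ _ c h2 h2'] at e
    simpa [coord_self] using ofCoords_injective e a
  -- The coordinates with indices `(a, c.2)` of the composite with the Segre embedding are those of
  -- the first factor, because the coordinate of the second factor with index `c.2` is `1`.
  constructor
  · refine hom_ext_of_coord (hg.trans hf.symm) fun y ↦ ?_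
    obtain ⟨U, c, h1, h1', h2, h2', hy, e⟩ := key y
    exact ⟨U, c.1, h1, h2, hy, fun a ↦ by simpa [coord_self] using e (a, c.2)⟩
  · refine hom_ext_of_coord (hg'.trans hf'.symm) fun y ↦ ?_
    obtain ⟨U, c, h1, h1', h2, h2', hy, e⟩ := key y
    exact ⟨U, c.2, h1', h2', hy, fun a ↦ by simpa [coord_self] using e (c.1, a)⟩

end Segre

end

/-! ### Permutations of the homogeneous coordinates -/

section
variable {k : Type u} [Field k] {ι κ : Type} {Y : Scheme.{u}}

lemma renameHom_apply (e : ι ≃ κ) (x : MvPolynomial κ k) : renameHom k e x = rename e.symm x := rfl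

lemma irrelevant_le_map_renameHom (e : ι ≃ κ) :
    HomogeneousIdeal.irrelevant (homogeneousSubmodule ι k) ≤
      (HomogeneousIdeal.irrelevant (homogeneousSubmodule κ k)).map (renameHom k e) :=
  irrelevant_le_map _ fun _ _ y hy ↦ ⟨rename e y, hy.rename_isHomogeneous, by
    rw [renameHom_apply, rename_rename]; simp⟩

/-- The morphism of schemes underlying `relabel`. -/
def relabelProj (e : ι ≃ κ) :
    Proj (homogeneousSubmodule ι k) ⟶ Proj (homogeneousSubmodule κ k) :=
  Proj.map (renameHom k e) (irrelevant_le_map_renameHom e)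

lemma evalHom_comp_renameHom (p : Y ⟶ Spec (.of k)) (v : ι → Γ(Y, ⊤)) (e : ι ≃ κ) :
    (evalHom p v).comp (renameHom k e).toRingHom = evalHom p (v ∘ e.symm) := by
  refine RingHom.ext fun x ↦ ?_
  refine (congrArg (evalHom p v) (renameHom_apply e x)).trans ?_
  rw [coe_eval₂Hom, coe_eval₂Hom, eval₂_rename]

lemma ofCoords_relabel (p : Y ⟶ Spec (.of k)) (v : ι → Γ(Y, ⊤)) (i : ι) (hv : IsUnit (v i))
    (e : ι ≃ κ) : ofCoords p v i hv ≫ relabelProj e =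
      ofCoords p (v ∘ e.symm) (e i) (by simpa using hv) := by
  have hX : (renameHom k e) (X (e i)) = X i := by
    rw [renameHom_apply, rename_X, e.symm_apply_apply]
  have hu : IsUnit (evalHom p v (renameHom k e (X (e i)))) := by
    rw [hX]
    simpa using hv
  have h := chart_map (homogeneousSubmodule κ k) (homogeneousSubmodule ι k) (renameHom k e)
    (irrelevant_le_map_renameHom e) (evalHom p v) (X_mem (e i)) one_pos hu
  rw [ofCoords, ofCoords]
  refine Eq.trans ?_ (h.trans (chart_congr _ (evalHom_comp_renameHom p v e) _ _ _ _ _))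
  congr 1
  exact chart_congr_elem _ _ hX.symm _ _ _ _ _

lemma comp_relabelProj (g : Y ⟶ Proj (homogeneousSubmodule ι k)) (i : ι)
    (h : ⊤ ≤ g ⁻¹ᵁ stdOpen i) (e : ι ≃ κ) :
    g ≫ relabelProj e = ofCoords (g ≫ projStr _) (coord g i h ∘ e.symm) (e i)
      (by simp [coord_self]) := by
  conv_lhs => rw [eq_ofCoords g i h]
  rw [ofCoords_relabel]

lemma top_le_preimage_comp_relabelProj (g : Y ⟶ Proj (homogeneousSubmodule ι k)) (i : ι)
    (h : ⊤ ≤ g ⁻¹ᵁ stdOpen i) (e : ι ≃ κ) : ⊤ ≤ (g ≫ relabelProj e) ⁻¹ᵁ stdOpen (e i) := by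
  rw [comp_relabelProj g i h, ofCoords_preimage, Function.comp_apply, e.symm_apply_apply,
    coord_self]
  simp

lemma coord_comp_relabelProj (g : Y ⟶ Proj (homogeneousSubmodule ι k)) (i : ι)
    (h : ⊤ ≤ g ⁻¹ᵁ stdOpen i) (e : ι ≃ κ) (h' : ⊤ ≤ (g ≫ relabelProj e) ⁻¹ᵁ stdOpen (e i)) (a : κ) :
    coord (g ≫ relabelProj e) (e i) h' a = coord g i h (e.symm a) := by
  have e1 := comp_relabelProj g i h e
  rw [coord_congr e1 _ h' (by rw [← e1]; exact h')]
  have := coord_ofCoords (g ≫ projStr _) (coord g i h ∘ e.symm) (e i) (by simp [coord_self])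
    (by rw [← e1]; exact h') a
  have h1 : (coord g i h ∘ e.symm) (e i) = 1 := by simp [coord_self]
  exact (mul_one _).symm.trans ((congrArg _ h1.symm).trans this)

/-- The Segre embedding is compatible with the identifications of the projective spaces of a formula
and its negation, which exchange the two factors. -/
lemma segreHom_relabel (p : Y ⟶ Spec (.of k)) (g : Y ⟶ Proj (homogeneousSubmodule ι k))
    (g' : Y ⟶ Proj (homogeneousSubmodule κ k)) {ι' κ' : Type} (e : ι ≃ ι') (e' : κ ≃ κ') :
    segreHom p g g' ≫ relabelProj ((Equiv.prodComm _ _).trans (e'.prodCongr e)) =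
      segreHom p (g' ≫ relabelProj e') (g ≫ relabelProj e) := by
  refine hom_ext_of_opens fun y ↦ ?_
  obtain ⟨U, c, hy, h, h'⟩ := exists_segre_box g g' y
  have h1 := top_le_preimage_comp_relabelProj _ _ h e
  have h2 := top_le_preimage_comp_relabelProj _ _ h' e'
  refine ⟨U, hy, ?_⟩
  rw [← Category.assoc, comp_segreHom_eq_ofCoords _ _ _ _ c h h', ofCoords_relabel]
  rw [Category.assoc] at h1 h2
  rw [comp_segreHom_eq_ofCoords _ _ _ _ (e' c.2, e c.1) h2 h1]
  refine ofCoords_congr rfl (funext fun a ↦ ?_) _ _ _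
  rw [coord_congr (Category.assoc _ _ _).symm _ h2 (by rwa [Category.assoc]),
    coord_congr (Category.assoc _ _ _).symm _ h1 (by rwa [Category.assoc]),
    coord_comp_relabelProj _ _ h', coord_comp_relabelProj _ _ h, mul_comm]
  simp only [Function.comp_apply, Equiv.symm_trans_apply, Equiv.prodComm_symm, Equiv.prodComm_apply,
    Equiv.prodCongr_symm, Equiv.prodCongr_apply, Prod.map_fst, Prod.map_snd, Prod.fst_swap,
    Prod.snd_swap]

end

/-! ### Coherence of points of proof structures -/

/-- An interpretation of formulas by sets of points, in which tensor and par are injective pairings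
that are exchanged by negation. -/
structure PointModel (V : Type v) where
  pt : Formula V → Type w
  neg (A : Formula V) : pt A ≃ pt A.neg
  tensor {A B : Formula V} : pt A → pt B → pt (.tensor A B)
  par {A B : Formula V} : pt A → pt B → pt (.par A B)
  tensor_inj {A B : Formula V} {x x' : pt A} {y y' : pt B} :
    tensor x y = tensor x' y' → x = x' ∧ y = y'
  par_inj {A B : Formula V} {x x' : pt A} {y y' : pt B} :
    par x y = par x' y' → x = x' ∧ y = y'
  neg_tensor {A B : Formula V} (x : pt A) (y : pt B) :
    neg (.tensor A B) (tensor x y) = par (neg B y) (neg A x)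
  neg_par {A B : Formula V} (x : pt A) (y : pt B) :
    neg (.par A B) (par x y) = tensor (neg B y) (neg A x)

namespace PointModel
variable {V : Type v} (D : PointModel.{v, w} V)

/-- Strict coherence of two points of a formula. Points of a tensor that decompose into pairs are
strictly coherent if they differ and both pairs of components are equal or strictly coherent; those
of a par, if one of the pairs of components is strictly coherent. Not every point of a tensor or par
need be a pair. Distinct points that do not both decompose are declared strictly coherent or not
according to the Boolean value `Formula.eval` of the formula; since this value is negated by
negation, exactly one of `A` and `¬A` makes two distinct points strictly coherent, see
`strictCoh_neg`. -/
def StrictCoh : (A : Formula V) → D.pt A → D.pt A → Prop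
  | .atom _ b, z, w => z ≠ w ∧ b = true
  | .tensor A B, z, w => z ≠ w ∧
      ((∃ x y x' y', z = D.tensor x y ∧ w = D.tensor x' y' ∧
        (x = x' ∨ StrictCoh A x x') ∧ (y = y' ∨ StrictCoh B y y')) ∨
      ((¬ ∃ x y x' y', z = D.tensor x y ∧ w = D.tensor x' y') ∧ (A.tensor B).eval = true))
  | .par A B, z, w => z ≠ w ∧
      ((∃ x y x' y', z = D.par x y ∧ w = D.par x' y' ∧
        (StrictCoh A x x' ∨ StrictCoh B y y')) ∨
      ((¬ ∃ x y x' y', z = D.par x y ∧ w = D.par x' y') ∧ (A.par B).eval = true))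

variable {D}

lemma StrictCoh.ne {A : Formula V} {z w : D.pt A} (h : D.StrictCoh A z w) : z ≠ w := by
  cases A <;> exact h.1

lemma strictCoh_tensor {A B : Formula V} {x x' : D.pt A} {y y' : D.pt B} :
    D.StrictCoh (.tensor A B) (D.tensor x y) (D.tensor x' y') ↔
      ¬ (x = x' ∧ y = y') ∧ (x = x' ∨ D.StrictCoh A x x') ∧ (y = y' ∨ D.StrictCoh B y y') := by
  have hne : D.tensor x y ≠ D.tensor x' y' ↔ ¬ (x = x' ∧ y = y') :=
    not_congr ⟨D.tensor_inj, by rintro ⟨rfl, rfl⟩; rfl⟩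
  rw [StrictCoh, hne]
  refine and_congr_right fun _ ↦ ⟨?_, fun h ↦ .inl ⟨x, y, x', y', rfl, rfl, h⟩⟩
  rintro (⟨a, b, a', b', h, h', H⟩ | ⟨h, -⟩)
  · obtain ⟨rfl, rfl⟩ := D.tensor_inj h
    obtain ⟨rfl, rfl⟩ := D.tensor_inj h'
    exact H
  · exact absurd ⟨x, y, x', y', rfl, rfl⟩ h

lemma strictCoh_par {A B : Formula V} {x x' : D.pt A} {y y' : D.pt B} :
    D.StrictCoh (.par A B) (D.par x y) (D.par x' y') ↔
      D.StrictCoh A x x' ∨ D.StrictCoh B y y' := by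
  rw [StrictCoh]
  constructor
  · rintro ⟨-, ⟨a, b, a', b', h, h', H⟩ | ⟨h, -⟩⟩
    · obtain ⟨rfl, rfl⟩ := D.par_inj h
      obtain ⟨rfl, rfl⟩ := D.par_inj h'
      exact H
    · exact absurd ⟨x, y, x', y', rfl, rfl⟩ h
  · intro h
    refine ⟨fun e ↦ ?_, .inl ⟨x, y, x', y', rfl, rfl, h⟩⟩
    obtain ⟨rfl, rfl⟩ := D.par_inj e
    exact h.elim (fun h ↦ h.ne rfl) (fun h ↦ h.ne rfl)

lemma exists_par_iff_tensor {A B : Formula V} (z w : D.pt (.tensor A B)) :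
    (∃ x y x' y', D.neg _ z = D.par (A := B.neg) (B := A.neg) x y ∧
      D.neg _ w = D.par (A := B.neg) (B := A.neg) x' y') ↔
      ∃ x y x' y', z = D.tensor x y ∧ w = D.tensor x' y' := by
  constructor
  · rintro ⟨x, y, x', y', h, h'⟩
    refine ⟨(D.neg A).symm y, (D.neg B).symm x, (D.neg A).symm y', (D.neg B).symm x', ?_, ?_⟩ <;>
    · apply (D.neg _).injective
      rw [D.neg_tensor]
      simpa
  · rintro ⟨x, y, x', y', rfl, rfl⟩
    exact ⟨_, _, _, _, D.neg_tensor _ _, D.neg_tensor _ _⟩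

lemma exists_tensor_iff_par {A B : Formula V} (z w : D.pt (.par A B)) :
    (∃ x y x' y', D.neg _ z = D.tensor (A := B.neg) (B := A.neg) x y ∧
      D.neg _ w = D.tensor (A := B.neg) (B := A.neg) x' y') ↔
      ∃ x y x' y', z = D.par x y ∧ w = D.par x' y' := by
  constructor
  · rintro ⟨x, y, x', y', h, h'⟩
    refine ⟨(D.neg A).symm y, (D.neg B).symm x, (D.neg A).symm y', (D.neg B).symm x', ?_, ?_⟩ <;>
    · apply (D.neg _).injective
      rw [D.neg_par]
      simpa
  · rintro ⟨x, y, x', y', rfl, rfl⟩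
    exact ⟨_, _, _, _, D.neg_par _ _, D.neg_par _ _⟩

/-- Two distinct points are strictly coherent for exactly one of `A` and `¬A`. -/
lemma strictCoh_neg {A : Formula V} {z w : D.pt A} :
    D.StrictCoh A.neg (D.neg A z) (D.neg A w) ↔ z ≠ w ∧ ¬ D.StrictCoh A z w := by
  induction A with
  | atom x b =>
    change D.neg _ z ≠ D.neg _ w ∧ (!b) = true ↔ z ≠ w ∧ ¬ (z ≠ w ∧ b = true)
    rw [(D.neg _).injective.ne_iff]
    cases b <;> simp
  | tensor A B hA hB =>
    by_cases h : ∃ x y x' y', z = D.tensor x y ∧ w = D.tensor x' y'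
    · obtain ⟨x, y, x', y', rfl, rfl⟩ := h
      have hne : D.tensor x y ≠ D.tensor x' y' ↔ ¬ (x = x' ∧ y = y') :=
        not_congr ⟨D.tensor_inj, by rintro ⟨rfl, rfl⟩; rfl⟩
      rw [D.neg_tensor, D.neg_tensor, hne, strictCoh_tensor]
      change D.StrictCoh (.par B.neg A.neg) _ _ ↔ _
      rw [strictCoh_par, hA, hB]
      tauto
    · change D.StrictCoh (.par B.neg A.neg) _ _ ↔ _
      have h' := (exists_par_iff_tensor z w).not.mpr h
      have e := Formula.eval_neg (A.tensor B)
      change (B.neg.par A.neg).eval = _ at e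
      have hi := (D.neg (.tensor A B)).injective.ne_iff (x := z) (y := w)
      change D.neg _ z ≠ D.neg _ w ∧ _ ↔ z ≠ w ∧ ¬ (z ≠ w ∧ _)
      rw [e, hi]
      cases (A.tensor B).eval <;> grind
  | par A B hA hB =>
    by_cases h : ∃ x y x' y', z = D.par x y ∧ w = D.par x' y'
    · obtain ⟨x, y, x', y', rfl, rfl⟩ := h
      have hne : D.par x y ≠ D.par x' y' ↔ ¬ (x = x' ∧ y = y') :=
        not_congr ⟨D.par_inj, by rintro ⟨rfl, rfl⟩; rfl⟩
      rw [D.neg_par, D.neg_par, hne, strictCoh_par]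
      change D.StrictCoh (.tensor B.neg A.neg) _ _ ↔ _
      rw [strictCoh_tensor, hA, hB, (D.neg A).injective.eq_iff, (D.neg B).injective.eq_iff]
      have h1 : x = x' → ¬ D.StrictCoh A x x' := fun e h ↦ h.ne e
      have h2 : y = y' → ¬ D.StrictCoh B y y' := fun e h ↦ h.ne e
      tauto
    · change D.StrictCoh (.tensor B.neg A.neg) _ _ ↔ _
      have h' := (exists_tensor_iff_par z w).not.mpr h
      have e := Formula.eval_neg (A.par B)
      change (B.neg.tensor A.neg).eval = _ at e
      have hi := (D.neg (.par A B)).injective.ne_iff (x := z) (y := w)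
      change D.neg _ z ≠ D.neg _ w ∧ _ ↔ z ≠ w ∧ ¬ (z ≠ w ∧ _)
      rw [e, hi]
      cases (A.par B).eval <;> grind

/-- The condition imposed by a link on a family of points. -/
def Holds {E : Type} {lab : E → Formula V} (x : ∀ e, D.pt (lab e)) : Link lab → Prop
  | .ax e e' h => h ▸ x e' = D.neg _ (x e)
  | .cut e e' h => h ▸ x e' = D.neg _ (x e)
  | .tensor a b c h => h ▸ x c = D.tensor (x a) (x b)
  | .par a b c h => h ▸ x c = D.par (x a) (x b)
  | .conc _ => True

lemma strictCoh_cast {A B : Formula V} (h : A = B) (z w : D.pt A) :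
    D.StrictCoh B (h ▸ z) (h ▸ w) ↔ D.StrictCoh A z w := by
  subst h; rfl

lemma cast_inj {A B : Formula V} (h : A = B) (z w : D.pt A) :
    h ▸ z = h ▸ w ↔ z = w := by
  subst h; rfl

section
variable {ζ : ProofStructure V} {x y : ∀ e, D.pt (ζ.lab e)}

/-- At edges with dual labels whose points correspond, two families of points are strictly coherent
at exactly one of the two edges, unless they agree at both. -/
lemma dual_edges {e e' : ζ.E} (h : ζ.lab e' = (ζ.lab e).neg)
    (hx : h ▸ x e' = D.neg _ (x e)) (hy : h ▸ y e' = D.neg _ (y e)) :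
    (x e' = y e' ↔ x e = y e) ∧
      (D.StrictCoh _ (x e') (y e') ↔ x e ≠ y e ∧ ¬ D.StrictCoh _ (x e) (y e)) := by
  rw [← cast_inj h, ← strictCoh_cast h, hx, hy, strictCoh_neg]
  exact ⟨(D.neg _).injective.eq_iff, .rfl⟩

/-- Two families of points satisfying all link conditions agree on all edges occurring in a
derivation, or are strictly coherent at some pending edge. The cut rule preserves this because
points cannot be strictly coherent for both `A` and `¬A`, and the tensor rule because each premise
comes with its own derivation. -/
lemma eq_or_strictCoh {Λ : Set ζ.L} {Γ : Set ζ.E} (h : ζ.Derivable Λ Γ)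
    (hx : ∀ l, Holds x (ζ.link l)) (hy : ∀ l, Holds y (ζ.link l)) :
    ((∀ e ∈ Γ, x e = y e) ∧ ∀ l ∈ Λ, ∀ e ∈ (ζ.link l).conclusions, x e = y e) ∨
      ∃ e ∈ Γ, D.StrictCoh _ (x e) (y e) := by
  induction h with
  | @ax l e e' h hl =>
    have hx := hl ▸ hx l
    have hy := hl ▸ hy l
    obtain ⟨h1, h2⟩ := dual_edges h hx hy
    by_cases he : x e = y e
    · left
      simp [hl, Link.conclusions, he, h1]
    · right
      by_cases hs : D.StrictCoh _ (x e) (y e)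
      · exact ⟨e, by simp, hs⟩
      · exact ⟨e', by simp, h2.mpr ⟨he, hs⟩⟩
  | @cut l e e' h Λ Λ' Γ Γ' hl hΓ hΓ' he he' hd hn ih ih' =>
    have hx := hl ▸ hx l
    have hy := hl ▸ hy l
    obtain ⟨h1, h2⟩ := dual_edges h hx hy
    rcases ih with ⟨ih, ihΛ⟩ | ⟨f, hf, hs⟩
    · rcases ih' with ⟨ih', ihΛ'⟩ | ⟨f', hf', hs'⟩
      · left
        refine ⟨fun f hf ↦ hf.elim (fun h ↦ ih f h.1) (fun h ↦ ih' f h.1), ?_⟩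
        rintro m (rfl | hm | hm)
        · simp [hl, Link.conclusions]
        · exact ihΛ m hm
        · exact ihΛ' m hm
      · right
        refine ⟨f', .inr ⟨hf', ?_⟩, hs'⟩
        rintro rfl
        exact (h2.mp hs').1 (ih e he)
    · right
      by_cases hfe : f = e
      · subst hfe
        rcases ih' with ⟨ih', ihΛ'⟩ | ⟨f', hf', hs'⟩
        · exact absurd (h1.mp (ih' e' he')) hs.ne
        · refine ⟨f', .inr ⟨hf', ?_⟩, hs'⟩
          rintro rfl
          exact (h2.mp hs').2 hs
      · exact ⟨f, .inl ⟨hf, hfe⟩, hs⟩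
  | @tensor l a b c h Λ Λ' Γ Γ' hl hΓ hΓ' ha hb hd hn ih ih' =>
    have hx : h ▸ x c = _ := hl ▸ hx l
    have hy : h ▸ y c = _ := hl ▸ hy l
    have hc : x a = y a → x b = y b → x c = y c := fun h1 h2 ↦ by
      rw [← cast_inj h, hx, hy, h1, h2]
    have hs := strictCoh_cast h (x c) (y c)
    rw [hx, hy, strictCoh_tensor] at hs
    rcases ih with ⟨ih, ihΛ⟩ | ⟨f, hf, hsf⟩
    · rcases ih' with ⟨ih', ihΛ'⟩ | ⟨f', hf', hsf'⟩
      · left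
        have hc := hc (ih a ha) (ih' b hb)
        refine ⟨?_, ?_⟩
        · rintro f (rfl | hf | hf)
          · exact hc
          · exact ih f hf.1
          · exact ih' f hf.1
        · rintro m (rfl | hm | hm)
          · simp [hl, Link.conclusions, hc]
          · exact ihΛ m hm
          · exact ihΛ' m hm
      · right
        by_cases hfb : f' = b
        · subst hfb
          exact ⟨c, .inl rfl, hs.mp ⟨fun h ↦ hsf'.ne h.2, .inl (ih a ha), .inr hsf'⟩⟩
        · exact ⟨f', .inr (.inr ⟨hf', hfb⟩), hsf'⟩
    · right
      by_cases hfa : f = a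
      · subst hfa
        rcases ih' with ⟨ih', ihΛ'⟩ | ⟨f', hf', hsf'⟩
        · exact ⟨c, .inl rfl, hs.mp ⟨fun h ↦ hsf.ne h.1, .inr hsf, .inl (ih' b hb)⟩⟩
        · by_cases hfb : f' = b
          · subst hfb
            exact ⟨c, .inl rfl, hs.mp ⟨fun h ↦ hsf.ne h.1, .inr hsf, .inr hsf'⟩⟩
          · exact ⟨f', .inr (.inr ⟨hf', hfb⟩), hsf'⟩
      · exact ⟨f, .inr (.inl ⟨hf, hfa⟩), hsf⟩
  | @par l a b c h Λ Γ hl hΓ ha hb hn ih =>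
    have hx : h ▸ x c = _ := hl ▸ hx l
    have hy : h ▸ y c = _ := hl ▸ hy l
    have hc : x a = y a → x b = y b → x c = y c := fun h1 h2 ↦ by
      rw [← cast_inj h, hx, hy, h1, h2]
    have hs := strictCoh_cast h (x c) (y c)
    rw [hx, hy, strictCoh_par] at hs
    rcases ih with ⟨ih, ihΛ⟩ | ⟨f, hf, hsf⟩
    · left
      have hc := hc (ih a ha) (ih b hb)
      refine ⟨?_, ?_⟩
      · rintro f (rfl | hf)
        · exact hc
        · exact ih f hf.1
      · rintro m (rfl | hm)
        · simp [hl, Link.conclusions, hc]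
        · exact ihΛ m hm
    · right
      by_cases hfa : f = a
      · exact ⟨c, .inl rfl, hs.mp (.inl (hfa ▸ hsf))⟩
      · by_cases hfb : f = b
        · exact ⟨c, .inl rfl, hs.mp (.inr (hfb ▸ hsf))⟩
        · exact ⟨f, .inr ⟨hf, by simp [hfa, hfb]⟩, hsf⟩

/-- In a proof net, a family of points satisfying all link conditions is determined by its values at
the conclusions: families that agree there are not strictly coherent at any conclusion. -/
theorem eq_of_eq_on_conclusions (h : ζ.IsProofNet) (hx : ∀ l, Holds x (ζ.link l))
    (hy : ∀ l, Holds y (ζ.link l)) (hc : ∀ e : ζ.Conclusion, x e.1 = y e.1) : x = y := by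
  rcases eq_or_strictCoh h hx hy with ⟨-, H⟩ | ⟨e, he, hs⟩
  · funext e
    obtain ⟨l, hl, -⟩ := ζ.existsUnique_conclusion e
    refine H l (fun f hf ↦ ?_) e hl
    simp [hf, Link.conclusions] at hl
  · exact absurd (hc ⟨e, he⟩) hs.ne

end
end PointModel

/-! ### `T`-valued points of `X(ζ)` -/

section
variable {k : Type u} [Field k] {ι κ : Type} {T : Over (Spec (.of k))}

lemma lift_segre_left (x : T ⟶ projectiveSpace k ι) (y : T ⟶ projectiveSpace k κ) :
    (prod.lift x y ≫ segre).left = segreHom T.hom x.left y.left := by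
  refine (comp_segreHom _ _ _ _).trans ?_
  have h1 : (prod.lift x y).left ≫ (prod.fst : projectiveSpace k ι ⨯ projectiveSpace k κ ⟶ _).left =
      x.left := by rw [← Over.comp_left, prod.lift_fst]
  have h2 : (prod.lift x y).left ≫ (prod.snd : projectiveSpace k ι ⨯ projectiveSpace k κ ⟶ _).left =
      y.left := by rw [← Over.comp_left, prod.lift_snd]
  have h3 := Over.w (prod.lift x y)
  erw [h1, h2, h3]

lemma lift_segre_injective {x x' : T ⟶ projectiveSpace k ι} {y y' : T ⟶ projectiveSpace k κ}
    (h : prod.lift x y ≫ segre = prod.lift x' y' ≫ segre) : x = x' ∧ y = y' := by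
  have h := congrArg (fun f ↦ Over.Hom.left f) h
  simp only [lift_segre_left] at h
  obtain ⟨h1, h2⟩ := segreHom_injective (Over.w x) (Over.w y) (Over.w x') (Over.w y') h
  exact ⟨Over.OverMorphism.ext h1, Over.OverMorphism.ext h2⟩

lemma lift_segre_relabel {ι' κ' : Type} (x : T ⟶ projectiveSpace k ι) (y : T ⟶ projectiveSpace k κ)
    (e : ι ≃ ι') (e' : κ ≃ κ') :
    (prod.lift x y ≫ segre) ≫ relabel k ((Equiv.prodComm _ _).trans (e'.prodCongr e)) =
      prod.lift (y ≫ relabel k e') (x ≫ relabel k e) ≫ segre := by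
  apply Over.OverMorphism.ext
  rw [Over.comp_left, lift_segre_left, lift_segre_left]
  exact segreHom_relabel _ _ _ _ _

lemma relabelProj_symm (e : ι ≃ κ) : relabelProj (k := k) e ≫ relabelProj e.symm = 𝟙 _ := by
  refine hom_ext_of_opens fun y ↦ ?_
  obtain ⟨i, hi⟩ := isOpenCover_stdOpen.exists_mem y
  refine ⟨stdOpen i, hi, ?_⟩
  have h : ⊤ ≤ (stdOpen i).ι ⁻¹ᵁ (stdOpen (k := k) i) := by simp
  rw [Category.comp_id, ← Category.assoc, eq_ofCoords _ i h, ofCoords_relabel, ofCoords_relabel]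
  simp [Function.comp_def]

/-- The isomorphism of projective spaces induced by a bijection of the homogeneous coordinates. -/
def relabelIso (e : ι ≃ κ) : projectiveSpace k ι ≅ projectiveSpace k κ where
  hom := relabel k e
  inv := relabel k e.symm
  hom_inv_id := Over.OverMorphism.ext (relabelProj_symm e)
  inv_hom_id := Over.OverMorphism.ext (relabelProj_symm e.symm)

variable (T) in
/-- The `T`-valued points of the projective spaces of formulas. -/
def pointModel (V : Type v) : PointModel.{v, u} V where
  pt A := T ⟶ A.space k
  neg A :=
    { toFun x := x ≫ A.spaceNeg k
      invFun x := x ≫ (relabelIso A.negCoord).inv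
      left_inv x := (Category.assoc _ _ _).trans
        ((congrArg (x ≫ ·) (relabelIso A.negCoord).hom_inv_id).trans (Category.comp_id x))
      right_inv x := (Category.assoc _ _ _).trans
        ((congrArg (x ≫ ·) (relabelIso A.negCoord).inv_hom_id).trans (Category.comp_id x)) }
  tensor {A B} x y := prod.lift x y ≫ A.segreTensor k B
  par {A B} x y := prod.lift x y ≫ A.segrePar k B
  tensor_inj h := lift_segre_injective h
  par_inj h := lift_segre_injective h
  neg_tensor {A B} x y := lift_segre_relabel x y A.negCoord B.negCoord
  neg_par {A B} x y := lift_segre_relabel x y A.negCoord B.negCoord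

section Nets
variable {V : Type v}

lemma eq_comp_of_comp_lift {P A B : Over (Spec (.of k))} {x : T ⟶ P} {p : P ⟶ A} {q : P ⟶ B}
    {g : T ⟶ A} {i : A ⟶ B} (h : x ≫ prod.lift p q = g ≫ prod.lift (𝟙 A) i) :
    x ≫ p = g ∧ x ≫ q = g ≫ i := by
  constructor
  · have h1 := congrArg (· ≫ prod.fst) h
    simpa only [Category.assoc, prod.lift_fst, Category.comp_id] using h1
  · have h1 := congrArg (· ≫ prod.snd) h
    simpa only [Category.assoc, prod.lift_snd] using h1

/-- The components of a `T`-valued point of `S(ζ)` that factors through the subscheme of a link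
satisfy the condition imposed by the link. -/
lemma holds_of_factors {E : Type} [Finite E] {lab : E → Formula V}
    (x : T ⟶ ∏ᶜ fun e ↦ (lab e).space k) (l : Link lab) (g : T ⟶ l.scheme k)
    (h : x ≫ l.projection k = g ≫ l.inclusion k) :
    (PointModel.Holds (D := pointModel T V) (fun e ↦ x ≫ Pi.π _ e) l) := by
  have dual {A B : Formula V} (e : B = A.neg) (y : T ⟶ A.space k) (z : T ⟶ B.space k)
      (hz : z = y ≫ A.spaceNeg k ≫ eqToHom (congrArg (Formula.space k) e.symm)) :
      (e ▸ z : T ⟶ A.neg.space k) = y ≫ A.spaceNeg k := by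
    subst e
    simpa using hz
  have pair {A B C F : Formula V} (e : F = C) (s : A.space k ⨯ B.space k ⟶ C.space k)
      (y : T ⟶ A.space k) (y' : T ⟶ B.space k) (z : T ⟶ F.space k)
      (hz : z = prod.lift y y' ≫ s ≫ eqToHom (congrArg (Formula.space k) e.symm)) :
      (e ▸ z : T ⟶ C.space k) = prod.lift y y' ≫ s := by
    subst e
    simpa using hz
  cases l with
  | ax e e' hl =>
    obtain ⟨h1, h2⟩ := eq_comp_of_comp_lift h
    exact dual hl _ _ (h2.trans (congrArg (· ≫ _) h1.symm))
  | cut e e' hl =>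
    obtain ⟨h1, h2⟩ := eq_comp_of_comp_lift h
    exact dual hl _ _ (h2.trans (congrArg (· ≫ _) h1.symm))
  | tensor a b c hl =>
    obtain ⟨h1, h2⟩ := eq_comp_of_comp_lift h
    refine pair hl (Formula.segreTensor k _ _) _ _ _ (h2.trans (congrArg (· ≫ _) ?_))
    rw [← h1, prod.comp_lift]
  | par a b c hl =>
    obtain ⟨h1, h2⟩ := eq_comp_of_comp_lift h
    refine pair hl (Formula.segrePar k _ _) _ _ _ (h2.trans (congrArg (· ≫ _) ?_))
    rw [← h1, prod.comp_lift]
  | conc e => trivial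

instance mono_link_inclusion {E : Type} {lab : E → Formula V} (l : Link lab) :
    Mono (l.inclusion k) := by
  cases l with
  | conc e => exact inferInstanceAs (Mono (𝟙 _))
  | _ => exact mono_of_mono_fac (h := 𝟙 _) (prod.lift_fst _ _)

variable (ζ : ProofStructure V)

/-- The projection from `X(ζ)` to the subscheme of the link `l`. -/
def linkProj (l : ζ.L) : ζ.scheme k ⟶ ζ.linkSubscheme k l := WidePullback.π _ l

lemma linkProj_ι (l : ζ.L) : linkProj ζ l ≫ ζ.linkSubschemeι k l = ζ.inclusion k :=
  WidePullback.π_arrow _ l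

/-- The projection from `X(ζ)` to `X(l)`. -/
def linkPoint (l : ζ.L) : ζ.scheme k ⟶ (ζ.link l).scheme k :=
  linkProj ζ l ≫ (pullback.snd _ _ : ζ.linkSubscheme k l ⟶ _)

/-- The projection from `S(ζ)` to the product over the edges incident to `l`. -/
def ambientProj (l : ζ.L) : ζ.ambient k ⟶ (ζ.link l).ambient k := (ζ.link l).projection k

lemma inclusion_comp_ambientProj (l : ζ.L) :
    ζ.inclusion k ≫ ambientProj ζ l = linkPoint ζ l ≫ (ζ.link l).inclusion k := by
  rw [← linkProj_ι ζ l, linkPoint, Category.assoc]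
  exact (congrArg (linkProj ζ l ≫ ·) pullback.condition).trans (Category.assoc _ _ _).symm

instance mono_linkSubschemeι (l : ζ.L) : Mono (ζ.linkSubschemeι k l) := by
  have := mono_link_inclusion (k := k) (ζ.link l)
  exact pullback.fst_of_mono

instance mono_inclusion : Mono (ζ.inclusion k) := by
  refine ⟨fun f g h ↦ WidePullback.hom_ext _ _ _ (fun l ↦ ?_) h⟩
  change f ≫ linkProj ζ l = g ≫ linkProj ζ l
  rw [← cancel_mono (ζ.linkSubschemeι k l), Category.assoc, Category.assoc, linkProj_ι, h]

lemma holds_of_hom_scheme (f : T ⟶ ζ.scheme k) (l : ζ.L) :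
    PointModel.Holds (D := pointModel T V) (fun e ↦ (f ≫ ζ.inclusion k) ≫ Pi.π _ e) (ζ.link l) := by
  refine holds_of_factors (f ≫ ζ.inclusion k) _ (f ≫ linkPoint ζ l) ?_
  rw [Category.assoc f, ← inclusion_comp_ambientProj, ← Category.assoc]
  rfl

lemma toConclusionSpace_π (j : ζ.Conclusion) :
    ζ.toConclusionSpace k ≫ Pi.π (fun j : ζ.Conclusion ↦ projectiveSpace k (ζ.lab j.1).Coord) j =
      Pi.π (fun e ↦ (ζ.lab e).space k) j.1 :=
  limit.lift_π _ _

/-- The morphism from `X(ζ)` to the product of the projective spaces of the conclusions is a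
monomorphism: a `T`-valued point of `X(ζ)` is a family of `T`-valued points of the edges that
satisfies all link conditions. -/
instance mono_inclusion_toConclusionSpace (ζ : ProofNet V) :
    Mono (ζ.inclusion k ≫ ζ.toConclusionSpace k) := by
  refine ⟨fun {T} f g h ↦ ?_⟩
  rw [← cancel_mono (ζ.inclusion k)]
  have key := PointModel.eq_of_eq_on_conclusions ζ.isProofNet (holds_of_hom_scheme _ f)
    (holds_of_hom_scheme _ g) fun j ↦ by
      have h' := congrArg
        (· ≫ Pi.π (fun j : ζ.Conclusion ↦ projectiveSpace k (ζ.lab j.1).Coord) j) h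
      simp only [← Category.assoc] at h'
      refine Eq.trans ?_ (h'.trans ?_)
      · exact (congrArg ((f ≫ ζ.inclusion k) ≫ ·) (toConclusionSpace_π _ j).symm).trans
          (Category.assoc _ _ _).symm
      · exact (Category.assoc _ _ _).trans
          (congrArg ((g ≫ ζ.inclusion k) ≫ ·) (toConclusionSpace_π _ j))
  exact Limits.Pi.hom_ext _ _ fun e ↦ congrFun key e

/-! ### Properness of `X(ζ)` -/

instance finite_coord (A : Formula V) : Finite A.Coord := by
  induction A with
  | atom x b => exact inferInstanceAs (Finite (Fin 2))
  | tensor A B hA hB => exact inferInstanceAs (Finite (A.Coord × B.Coord))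
  | par A B hA hB => exact inferInstanceAs (Finite (A.Coord × B.Coord))

lemma isProper_space (A : Formula V) : IsProper (A.space k).hom := isProper_projectiveSpace _

lemma isProper_pi {J : Type} [Finite J] (F : J → Over (Spec (.of k)))
    (h : ∀ j, IsProper (F j).hom) : IsProper (∏ᶜ F).hom := by
  have := Fintype.ofFinite J
  exact isProper_limit (Discrete.functor F) fun j ↦ h j.as

lemma isProper_prod {A B : Over (Spec (.of k))} (hA : IsProper A.hom) (hB : IsProper B.hom) :
    IsProper (A ⨯ B).hom :=
  isProper_limit (pair A B) (by rintro ⟨_ | _⟩ <;> assumption)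

lemma isProper_linkSubscheme (l : ζ.L) : IsProper (ζ.linkSubscheme k l).hom := by
  have hS : IsProper (ζ.ambient k).hom := isProper_pi _ fun e ↦ isProper_space _
  have hX (l : Link ζ.lab) : IsProper (l.ambient k).hom ∧ IsProper (l.scheme k).hom := by
    cases l
    · exact ⟨isProper_prod (isProper_space _) (isProper_space _), isProper_space _⟩
    · exact ⟨isProper_prod (isProper_space _) (isProper_space _), isProper_space _⟩
    · exact ⟨isProper_prod (isProper_prod (isProper_space _) (isProper_space _)) (isProper_space _),
        isProper_prod (isProper_space _) (isProper_space _)⟩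
    · exact ⟨isProper_prod (isProper_prod (isProper_space _) (isProper_space _)) (isProper_space _),
        isProper_prod (isProper_space _) (isProper_space _)⟩
    · exact ⟨isProper_space _, isProper_space _⟩
  refine isProper_limit (cospan ((ζ.link l).projection k) ((ζ.link l).inclusion k)) ?_
  rintro (_ | _ | _)
  · exact (hX _).1
  · exact hS
  · exact (hX _).2

lemma isProper_scheme : IsProper (ζ.scheme k).hom := by
  classical
  refine isProper_limit (WidePullbackShape.wideCospan (ζ.ambient k) (ζ.linkSubscheme k)
    (ζ.linkSubschemeι k)) ?_
  rintro (_ | l)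
  · exact isProper_pi _ fun e ↦ isProper_space _
  · exact isProper_linkSubscheme ζ l

lemma isProper_conclusionSpace : IsProper (ζ.conclusionSpace k).hom :=
  isProper_pi _ fun _ ↦ isProper_projectiveSpace _

/-- The morphism from `X(ζ)` to the product of the projective spaces of the conclusions is a proper
monomorphism, hence a closed immersion. -/
theorem isClosedImmersion_conclusions (ζ : ProofNet V) :
    IsClosedImmersion (ζ.inclusion k ≫ ζ.toConclusionSpace k).left := by
  rw [IsClosedImmersion.iff_isProper_and_mono]
  refine ⟨?_, inferInstance⟩
  have h1 := isProper_scheme (k := k) ζ.toProofStructure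
  have h2 := isProper_conclusionSpace (k := k) ζ.toProofStructure
  have h3 := Over.w (ζ.inclusion k ≫ ζ.toConclusionSpace k)
  rw [← h3] at h1
  exact IsProper.of_comp _ (ζ.conclusionSpace k).hom

end Nets

end

/-! ### The morphism to `Proj` of the Cartesian product -/

section Box
variable {k : Type u} [Field k] {J : Type} {ι : J → Type} {Y : Scheme.{u}}

/-- Substitution of `v` for the variables in the Cartesian product of polynomial rings. -/
def boxEval (p : Y ⟶ Spec (.of k)) (v : (Σ j, ι j) → Γ(Y, ⊤)) : Cartesian k ι →+* Γ(Y, ⊤) :=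
  (evalHom p v).comp (algebraMap (Cartesian k ι) (MvPolynomial (Σ j, ι j) k))

lemma boxEval_apply (p : Y ⟶ Spec (.of k)) (v : (Σ j, ι j) → Γ(Y, ⊤)) (x : Cartesian k ι) :
    boxEval p v x = evalHom p v x.1 := rfl

lemma comp_boxEval {Z : Scheme.{u}} (f : Z ⟶ Y) (p : Y ⟶ Spec (.of k))
    (v : (Σ j, ι j) → Γ(Y, ⊤)) :
    f.appTop.hom.comp (boxEval p v) = boxEval (f ≫ p) fun s ↦ f.appTop.hom (v s) := by
  rw [boxEval, ← RingHom.comp_assoc, comp_evalHom]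
  rfl

lemma projStr_comp (j : J) {T : Over (Spec (.of k))} (x : T ⟶ projectiveSpace k (ι j)) :
    x.left ≫ projStr (homogeneousSubmodule (ι j) k) = T.hom := Over.w x

section BoxCoords
variable (g : ∀ j, Y ⟶ Proj (homogeneousSubmodule (ι j) k))

/-- The functions `x_{j,a} / x_{j, c j}` on a scheme mapped by `g` to the open set where all
`x_{j, c j}` are non-zero. -/
def boxCoords (c : ∀ j, ι j) (h : ∀ j, ⊤ ≤ g j ⁻¹ᵁ stdOpen (c j)) (s : Σ j, ι j) : Γ(Y, ⊤) :=
  coord (g s.1) (c s.1) (h s.1) s.2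

variable {g} in
lemma boxCoords_congr {g' : ∀ j, Y ⟶ Proj (homogeneousSubmodule (ι j) k)} (e : ∀ j, g j = g' j)
    (c : ∀ j, ι j) (h : ∀ j, ⊤ ≤ g j ⁻¹ᵁ stdOpen (c j)) (h' : ∀ j, ⊤ ≤ g' j ⁻¹ᵁ stdOpen (c j)) :
    boxCoords g c h = boxCoords g' c h' :=
  funext fun s ↦ coord_congr (e s.1) _ _ _ _

lemma boxCoords_self (c : ∀ j, ι j) (h : ∀ j, ⊤ ≤ g j ⁻¹ᵁ stdOpen (c j)) (j : J) :
    boxCoords g c h ⟨j, c j⟩ = 1 := coord_self _ _ _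

end BoxCoords

variable [Fintype J]

lemma boxEval_boxMonomial (p : Y ⟶ Spec (.of k)) (v : (Σ j, ι j) → Γ(Y, ⊤)) (c : ∀ j, ι j) :
    boxEval p v (boxMonomial c) = ∏ j, v ⟨j, c j⟩ := by
  rw [boxEval_apply, coe_boxMonomial]
  simp

variable (k) in
lemma boxMonomial_mem (c : ∀ j, ι j) : (boxMonomial c : Cartesian k ι) ∈ cartesianPiece k ι 1 :=
  monomial_mem k c

lemma mem_basicOpen_prod (f : J → Γ(Y, ⊤)) (y : Y) :
    y ∈ Y.basicOpen (∏ j, f j) ↔ ∀ j, y ∈ Y.basicOpen (f j) := by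
  simp only [Scheme.mem_basicOpen_top, map_prod, IsUnit.prod_univ_iff]

section ToProj
variable (g : ∀ j, Y ⟶ Proj (homogeneousSubmodule (ι j) k))

lemma isUnit_boxEval_boxCoords (p : Y ⟶ Spec (.of k)) (c : ∀ j, ι j)
    (h : ∀ j, ⊤ ≤ g j ⁻¹ᵁ stdOpen (c j)) :
    IsUnit (boxEval p (boxCoords g c h) (boxMonomial c)) := by
  rw [boxEval_boxMonomial]
  simp [boxCoords_self]

lemma exists_lift_boxOpen {W : Scheme.{u}} (f : W ⟶ Y) (c : ∀ j, ι j)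
    (h : ∀ j, ⊤ ≤ (f ≫ g j) ⁻¹ᵁ stdOpen (c j)) : ∃ l : W ⟶ boxOpen g c, l ≫ (boxOpen g c).ι = f :=
  ⟨IsOpenImmersion.lift (boxOpen g c).ι f (by
    rintro _ ⟨y, rfl⟩
    rw [Scheme.Opens.range_ι]
    exact Set.mem_iInter.mpr fun j ↦ h j (x := y) trivial), IsOpenImmersion.lift_fac _ _ _⟩

/-- Locally, some coordinate of each `g j` does not vanish. -/
lemma exists_box (y : Y) : ∃ (U : Y.Opens) (c : ∀ j, ι j), y ∈ U ∧
    ∀ j, ⊤ ≤ (U.ι ≫ g j) ⁻¹ᵁ stdOpen (c j) := by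
  obtain ⟨c, hc⟩ := (isOpenCover_boxOpen g).exists_mem y
  exact ⟨boxOpen g c, c, hc, boxOpen_top_le g c⟩

variable [Nonempty J] (p : Y ⟶ Spec (.of k))

lemma ι_toProjCartesian (c : ∀ j, ι j) : (boxOpen g c).ι ≫ toProjCartesian g p =
    chart (cartesianPiece k ι) (boxHom g p c) (boxMonomial c) (boxMonomial_mem k c) one_pos
      (boxHom_isUnit g p c) :=
  ι_glueCharts _ _ _ _ _ _ _ _ _ _ c

lemma comp_toProjCartesian_eq_chart {W : Scheme.{u}} (f : W ⟶ Y) (c : ∀ j, ι j)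
    (h : ∀ j, ⊤ ≤ (f ≫ g j) ⁻¹ᵁ stdOpen (c j)) :
    f ≫ toProjCartesian g p = chart (cartesianPiece k ι)
      (boxEval (f ≫ p) (boxCoords (fun j ↦ f ≫ g j) c h)) (boxMonomial c) (boxMonomial_mem k c)
      one_pos (isUnit_boxEval_boxCoords _ _ _ _) := by
  obtain ⟨l, rfl⟩ := exists_lift_boxOpen g f c h
  rw [Category.assoc, ι_toProjCartesian, comp_chart]
  refine chart_congr _ ?_ _ _ _ _ _
  refine (comp_boxEval l _ (boxCoord g c)).trans ?_
  rw [Category.assoc]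
  congr 1
  funext s
  have h' : ⊤ ≤ (l ≫ (boxOpen g c).ι ≫ g s.1) ⁻¹ᵁ stdOpen (c s.1) := by
    rw [← Category.assoc]; exact h s.1
  rw [boxCoord, comp_coord l _ _ _ h', boxCoords]
  exact coord_congr (Category.assoc _ _ _).symm _ _ _ _

lemma comp_toProjCartesian {W : Scheme.{u}} (f : W ⟶ Y) :
    f ≫ toProjCartesian g p = toProjCartesian (fun j ↦ f ≫ g j) (f ≫ p) := by
  refine hom_ext_of_opens fun y ↦ ?_
  obtain ⟨U, c, hy, h⟩ := exists_box (fun j ↦ f ≫ g j) y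
  refine ⟨U, hy, ?_⟩
  have h' : ∀ j, ⊤ ≤ ((U.ι ≫ f) ≫ g j) ⁻¹ᵁ stdOpen (c j) := fun j ↦ by
    rw [Category.assoc]; exact h j
  rw [← Category.assoc, comp_toProjCartesian_eq_chart g p (U.ι ≫ f) c h',
    comp_toProjCartesian_eq_chart _ _ U.ι c h]
  refine chart_congr _ ?_ _ _ _ _ _
  rw [Category.assoc]
  exact congrArg _ (boxCoords_congr (fun j ↦ Category.assoc _ _ _) c h' h)

lemma toProjCartesian_preimage (c : ∀ j, ι j) :
    toProjCartesian g p ⁻¹ᵁ Proj.basicOpen (cartesianPiece k ι) (boxMonomial c) = boxOpen g c := by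
  ext y
  obtain ⟨U, d, hy, h⟩ := exists_box g y
  have e := comp_toProjCartesian_eq_chart g p U.ι d h
  have e' := congrArg (fun f ↦ f ⁻¹ᵁ Proj.basicOpen (cartesianPiece k ι) (boxMonomial c)) e
  rw [chart_preimage_basicOpen _ _ _ _ _ (boxMonomial_mem k c) one_pos, boxEval_boxMonomial] at e'
  have h1 := congrArg (fun V : U.toScheme.Opens ↦ (⟨y, hy⟩ : U) ∈ V) e'
  refine h1.to_iff.trans ?_
  refine (mem_basicOpen_prod _ _).trans ?_
  refine Iff.trans (forall_congr' fun j ↦ ?_)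
    (Set.mem_iInter (s := fun j ↦ (g j ⁻¹ᵁ stdOpen (c j) : Set Y))).symm
  rw [boxCoords, basicOpen_coord]
  exact Iff.rfl

variable {g p} in
/-- The functions `x_{j,a} / x_{j, c j}` are recovered from the products of variables: exchanging
the factor `x_{j, c j}` of `∏_i x_{i, c i}` for `x_{j,a}` multiplies it by `x_{j,a} / x_{j, c j}`.
-/
lemma toProjCartesian_injective {g' : ∀ j, Y ⟶ Proj (homogeneousSubmodule (ι j) k)}
    (hg : ∀ j, g j ≫ projStr _ = p) (hg' : ∀ j, g' j ≫ projStr _ = p)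
    (h : toProjCartesian g p = toProjCartesian g' p) : g = g' := by
  classical
  funext j
  refine hom_ext_of_coord ((hg j).trans (hg' j).symm) fun y ↦ ?_
  obtain ⟨c, hc⟩ := (isOpenCover_boxOpen g).exists_mem y
  have hU : boxOpen g c = boxOpen g' c := by
    rw [← toProjCartesian_preimage g p, h, toProjCartesian_preimage]
  have h1 := boxOpen_top_le g c
  have h2 : ∀ j, ⊤ ≤ ((boxOpen g c).ι ≫ g' j) ⁻¹ᵁ stdOpen (c j) := by
    rw [hU]
    exact boxOpen_top_le g' c
  refine ⟨boxOpen g c, c j, h1 j, h2 j, hc, fun a ↦ ?_⟩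
  have e := congrArg ((boxOpen g c).ι ≫ ·) h
  rw [comp_toProjCartesian_eq_chart g p _ c h1, comp_toProjCartesian_eq_chart g' p _ c h2] at e
  have e' := chart_injective _ e 1 (boxMonomial (Function.update c j a)) (boxMonomial_mem k _)
  simp only [boxEval_boxMonomial, boxCoords_self, Finset.prod_const_one, one_pow, mul_one] at e'
  have hv (v : (Σ j, ι j) → Γ(boxOpen g c, ⊤)) (hv : ∀ j, v ⟨j, c j⟩ = 1) :
      ∏ i, v ⟨i, Function.update c j a i⟩ = v ⟨j, a⟩ := by
    rw [Finset.prod_eq_single j]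
    · simp
    · intro i _ hi
      rw [Function.update_of_ne hi, hv]
    · simp
  rw [hv _ (boxCoords_self _ c h1), hv _ (boxCoords_self _ c h2)] at e'
  exact e'

lemma toProjCartesian_projStr : toProjCartesian g p ≫ projStr _ = p :=
  glueCharts_projStr _ _ _ _ _ _ _ _ _ _ p fun c ↦ by
    ext x
    exact (evalHom_scalars ((boxOpen g c).ι ≫ p) (boxCoord g c)).symm ▸ rfl

end ToProj

variable [Nonempty J]

lemma left_comp_prodToProj {T : Over (Spec (.of k))} (F : T ⟶ ∏ᶜ fun j ↦ projectiveSpace k (ι j)) :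
    F.left ≫ prodToProj ι = toProjCartesian (fun j ↦ (F ≫ Pi.π _ j).left) T.hom := by
  refine (comp_toProjCartesian _ _ _).trans ?_
  congr 1
  exact Over.w F

variable (k ι) in
/-- The morphism from a product of projective spaces to `Proj` of the Cartesian product is a proper
monomorphism, hence a closed immersion. -/
lemma isClosedImmersion_prodToProj [∀ j, Finite (ι j)] :
    IsClosedImmersion (prodToProj (k := k) ι) := by
  let P := ∏ᶜ fun j ↦ projectiveSpace k (ι j)
  have hw : prodToProj (k := k) ι ≫ projStr _ = P.hom := toProjCartesian_projStr _ _
  rw [IsClosedImmersion.iff_isProper_and_mono]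
  constructor
  · have h1 : IsProper P.hom := isProper_pi _ fun j ↦ isProper_projectiveSpace _
    have h2 := isSeparated_projStr (cartesianPiece k ι)
    rw [← hw] at h1
    exact IsProper.of_comp _ (projStr (cartesianPiece k ι))
  · refine ⟨fun {Z} f f' h ↦ ?_⟩
    have hf : f ≫ P.hom = f' ≫ P.hom := by
      rw [← hw, ← Category.assoc, h, Category.assoc]
    let F : Over.mk (f ≫ P.hom) ⟶ P := Over.homMk f rfl
    let F' : Over.mk (f ≫ P.hom) ⟶ P := Over.homMk f' hf.symm
    have h' : F.left ≫ prodToProj ι = F'.left ≫ prodToProj ι := h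
    rw [left_comp_prodToProj, left_comp_prodToProj] at h'
    have key := toProjCartesian_injective (fun j ↦ projStr_comp j (F ≫ Pi.π _ j))
      (fun j ↦ projStr_comp j (F' ≫ Pi.π _ j)) h'
    have : F = F' := Limits.Pi.hom_ext _ _ fun j ↦ Over.OverMorphism.ext (congrFun key j)
    exact congrArg Over.Hom.left this

end Box

/-! ### Functions on the standard open subsets of `Proj` -/

section
variable {k : Type u} [Field k] {A : Type u} [CommRing A] [Algebra k A]
  {𝒜 : ℕ → Submodule k A} [GradedAlgebra 𝒜]

lemma awayToSection_bijective {f : A} {m : ℕ} (hf : f ∈ 𝒜 m) (hm : 0 < m) :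
    Function.Bijective (Proj.awayToSection 𝒜 f) := by
  rw [← Proj.basicOpenIsoAway_hom 𝒜 f hf hm]
  exact ConcreteCategory.bijective_of_isIso _

/-- The quotient `x / f ^ n`, for `x` of degree `n` and `f` of degree one, as a function on the open
set `f ≠ 0`. -/
def fraction {f : A} (hf : f ∈ 𝒜 1) {n : ℕ} {x : A} (hx : x ∈ 𝒜 n) :
    Γ(Proj 𝒜, Proj.basicOpen 𝒜 f) :=
  Proj.awayToSection 𝒜 f (Away.mk 𝒜 hf n x (by simpa using hx))

lemma exists_eq_fraction {f : A} (hf : f ∈ 𝒜 1) (s : Γ(Proj 𝒜, Proj.basicOpen 𝒜 f)) :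
    ∃ (n : ℕ) (x : A) (hx : x ∈ 𝒜 n), fraction hf hx = s := by
  obtain ⟨z, rfl⟩ := (awayToSection_bijective hf one_pos).2 s
  obtain ⟨n, x, hx, rfl⟩ := Away.mk_surjective 𝒜 hf z
  exact ⟨n, x, by simpa using hx, rfl⟩

lemma fraction_mul {f : A} (hf : f ∈ 𝒜 1) {m n l : ℕ} {x y : A} (hx : x ∈ 𝒜 m) (hy : y ∈ 𝒜 n)
    (e : m + n = l) (hxy : x * y ∈ 𝒜 l) :
    fraction hf hxy = fraction hf hx * fraction hf hy := by
  subst e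
  rw [fraction, fraction, fraction]
  refine Eq.trans (congrArg _ ?_) (map_mul (Proj.awayToSection 𝒜 f).hom _ _)
  ext
  simp [Away.val_mk, Localization.mk_mul, pow_add]

lemma fraction_add {f : A} (hf : f ∈ 𝒜 1) {n : ℕ} {x y : A} (hx : x ∈ 𝒜 n) (hy : y ∈ 𝒜 n)
    (hxy : x + y ∈ 𝒜 n) : fraction hf hxy = fraction hf hx + fraction hf hy := by
  rw [fraction, fraction, fraction]
  refine Eq.trans (congrArg _ ?_) (map_add (Proj.awayToSection 𝒜 f).hom _ _)
  ext
  simp [Away.val_mk, Localization.add_mk_self]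

lemma fraction_zero {f : A} (hf : f ∈ 𝒜 1) {n : ℕ} (h : (0 : A) ∈ 𝒜 n) : fraction hf h = 0 := by
  rw [fraction]
  refine Eq.trans (congrArg _ ?_) (map_zero (Proj.awayToSection 𝒜 f).hom)
  ext
  simp [Away.val_mk, Localization.mk_zero]

lemma fraction_pow_self {f : A} (hf : f ∈ 𝒜 1) {n : ℕ} (h : f ^ n ∈ 𝒜 n) : fraction hf h = 1 := by
  rw [fraction]
  refine Eq.trans (congrArg _ ?_) (map_one (Proj.awayToSection 𝒜 f).hom)
  ext
  rw [Away.val_mk, val_one]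
  exact Localization.mk_self (⟨f ^ n, n, rfl⟩ : Submonoid.powers f)

lemma pow_mem_degree {f : A} (hf : f ∈ 𝒜 1) (n : ℕ) : f ^ n ∈ 𝒜 n := by
  simpa using SetLike.pow_mem_graded n hf

lemma fraction_congr {f : A} (hf : f ∈ 𝒜 1) {n : ℕ} {x y : A} (h : x = y) (hx : x ∈ 𝒜 n)
    (hy : y ∈ 𝒜 n) : fraction hf hx = fraction hf hy := by
  subst h; rfl

lemma fraction_pow {f g : A} (hf : f ∈ 𝒜 1) (hg : g ∈ 𝒜 1) {n : ℕ} (h : g ^ n ∈ 𝒜 n) :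
    fraction hf h = fraction hf hg ^ n := by
  induction n with
  | zero =>
    refine (fraction_congr hf (y := f ^ 0) (by simp) h (pow_mem_degree hf 0)).trans ?_
    rw [fraction_pow_self]
    exact (pow_zero _).symm
  | succ n ih =>
    have h' := pow_mem_degree hg n
    refine Eq.trans ?_ (pow_succ _ n).symm
    rw [← ih h']
    refine (fraction_congr hf (pow_succ g n) h
      (SetLike.mul_mem_graded (i := n) (j := 1) h' hg)).trans ?_
    exact fraction_mul hf h' hg rfl _

/-- The function `g / f` on `f ≠ 0` is invertible only where `g ≠ 0`. -/
lemma basicOpen_fraction_le {f g : A} (hf : f ∈ 𝒜 1) (hg : g ∈ 𝒜 1) :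
    (Proj 𝒜).basicOpen (fraction hf hg) ≤ Proj.basicOpen 𝒜 g := by
  intro y hy
  let U : (Proj 𝒜).Opens := Proj.basicOpen 𝒜 f
  have hyU : y ∈ U := (Proj 𝒜).basicOpen_le _ hy
  have hU : ⊤ ≤ U.ι ⁻¹ᵁ U := fun z _ ↦ z.2
  have e := eq_toSpecΓ_awayι 𝒜 U.ι hf one_pos hU
  have e' := congrArg (fun i ↦ i ⁻¹ᵁ Proj.basicOpen 𝒜 g) e
  simp only [Scheme.Hom.comp_preimage] at e'
  rw [Proj.awayι_preimage_basicOpen 𝒜 hf one_pos hg one_pos] at e'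
  have hz : Away.isLocalizationElem hf hg = Away.mk 𝒜 hf 1 g (by simpa using hg) := by
    ext
    simp [Away.isLocalizationElem, Away.val_mk]
  have e2 : U.ι ⁻¹ᵁ Proj.basicOpen 𝒜 g =
      U.toScheme.basicOpen (U.ι.appLE U ⊤ hU (fraction hf hg)) := by
    refine e'.trans ?_
    rw [hz]
    exact Scheme.toSpecΓ_preimage_basicOpen _ _
  have e3 : (⟨y, hyU⟩ : U) ∈ U.toScheme.basicOpen (U.ι.appLE U ⊤ hU (fraction hf hg)) := by
    rw [Scheme.Hom.appLE, CommRingCat.comp_apply, Scheme.basicOpen_res,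
      ← Scheme.preimage_basicOpen]
    exact ⟨trivial, hy⟩
  rw [← e2] at e3
  exact e3

/-- On `f g ≠ 0`, the function `x / f ^ n` equals `(x / g ^ n) (g / f) ^ n`. -/
lemma fraction_res {f g : A} (hf : f ∈ 𝒜 1) (hg : g ∈ 𝒜 1) {n : ℕ} {x : A} (hx : x ∈ 𝒜 n)
    {V : (Proj 𝒜).Opens} (hVf : V ≤ Proj.basicOpen 𝒜 f) (hVg : V ≤ Proj.basicOpen 𝒜 g) :
    (Proj 𝒜).presheaf.map (homOfLE hVf).op (fraction hf hx) =
      (Proj 𝒜).presheaf.map (homOfLE hVg).op (fraction hg hx) *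
      (Proj 𝒜).presheaf.map (homOfLE hVf).op (fraction hf (pow_mem_degree hg n)) := by
  have hV : V ≤ Proj.basicOpen 𝒜 (f * g) := by
    rw [Proj.basicOpen_mul]
    exact le_inf hVf hVg
  have e1 (y : A) (hy : y ∈ 𝒜 n) : (Proj 𝒜).presheaf.map (homOfLE hVf).op (fraction hf hy) =
      (Proj 𝒜).presheaf.map (homOfLE hV).op (Proj.awayToSection 𝒜 (f * g)
        (awayMap _ hg rfl (Away.mk _ hf n y (by simpa using hy)))) := by
    have := ConcreteCategory.congr_hom
      (Proj.awayMap_awayToSection 𝒜 hg (f := f) rfl) (Away.mk _ hf n y (by simpa using hy))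
    refine Eq.trans ?_ (congrArg ((Proj 𝒜).presheaf.map (homOfLE hV).op) this).symm
    rw [fraction]
    simp only [← ConcreteCategory.comp_apply, Category.assoc, ← Functor.map_comp]
    rfl
  have e2 : (Proj 𝒜).presheaf.map (homOfLE hVg).op (fraction hg hx) =
      (Proj 𝒜).presheaf.map (homOfLE hV).op (Proj.awayToSection 𝒜 (f * g)
        (awayMap _ hf (mul_comm _ _) (Away.mk _ hg n x (by simpa using hx)))) := by
    have := ConcreteCategory.congr_hom
      (Proj.awayMap_awayToSection 𝒜 hf (f := g) (mul_comm _ _))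
      (Away.mk _ hg n x (by simpa using hx))
    refine Eq.trans ?_ (congrArg ((Proj 𝒜).presheaf.map (homOfLE hV).op) this).symm
    rw [fraction]
    simp only [← ConcreteCategory.comp_apply, Category.assoc, ← Functor.map_comp]
    rfl
  rw [e1, e1, e2, ← map_mul]
  refine congrArg _ (Eq.trans (congrArg _ ?_) (map_mul (Proj.awayToSection 𝒜 (f * g)).hom _ _))
  ext
  rw [val_mul, awayMap_mk, awayMap_mk, awayMap_mk, Away.val_mk, Away.val_mk, Away.val_mk,
    Localization.mk_mul, Localization.mk_eq_mk_iff, Localization.r_iff_exists]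
  refine ⟨1, ?_⟩
  simp
  ring

end

/-! ### The homogeneous ideal of an ideal sheaf on `Proj` -/

/-- A function on an affine open set whose restriction to `t ≠ 0` lies in a quasi-coherent ideal
sheaf lies in it after multiplication by some power of `t`. -/
lemma exists_pow_mul_mem {X : Scheme.{u}} (K : X.IdealSheafData) (U : X.affineOpens) (t s : Γ(X, U))
    (h : X.presheaf.map (homOfLE (X.basicOpen_le t)).op s ∈ K.ideal (X.affineBasicOpen t)) :
    ∃ n, t ^ n * s ∈ K.ideal U := by
  have := U.2.isLocalization_basicOpen t
  rw [← K.map_ideal_basicOpen] at h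
  obtain ⟨⟨i, ⟨_, m, rfl⟩⟩, hi⟩ := (IsLocalization.mem_map_algebraMap_iff (.powers t)
    Γ(X, X.basicOpen t)).mp h
  have hi' : algebraMap Γ(X, U) Γ(X, X.basicOpen t) (t ^ m * s) = algebraMap _ _ i.1 := by
    rw [map_mul, mul_comm]
    exact hi
  obtain ⟨⟨_, l, rfl⟩, hl⟩ := (IsLocalization.eq_iff_exists (.powers t) _).mp hi'
  refine ⟨l + m, ?_⟩
  rw [pow_add, mul_assoc]
  exact hl ▸ Ideal.mul_mem_left _ _ i.2

section
variable {k : Type u} [Field k] {A : Type u} [CommRing A] [Algebra k A]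
  {𝒜 : ℕ → Submodule k A} [GradedAlgebra 𝒜]

/-- The affine open subscheme `f ≠ 0` of `Proj 𝒜`, for `f` of degree one. -/
abbrev affineBasicOpen {f : A} (hf : f ∈ 𝒜 1) : (Proj 𝒜).affineOpens :=
  ⟨Proj.basicOpen 𝒜 f, Proj.isAffineOpen_basicOpen 𝒜 f hf one_pos⟩

section Ideal
variable {C : Type*} {f : C → A} (hf : ∀ c, f c ∈ 𝒜 1) (K : (Proj 𝒜).IdealSheafData)

lemma fraction_decompose_mul_mem {g : A} (hg : g ∈ 𝒜 1) (a x : A)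
    (hx : ∀ n, fraction hg (DirectSum.decompose 𝒜 x n).2 ∈ K.ideal (affineBasicOpen hg)) (n : ℕ) :
    fraction hg (DirectSum.decompose 𝒜 (a * x) n).2 ∈ K.ideal (affineBasicOpen hg) := by
  induction a using DirectSum.Decomposition.inductionOn 𝒜 with
  | zero =>
    rw [fraction_congr hg (y := 0) (by simp) _ (zero_mem _), fraction_zero]
    exact zero_mem _
  | @homogeneous i a =>
    by_cases h : i ≤ n
    · rw [fraction_congr hg (DirectSum.coe_decompose_mul_of_left_mem_of_le 𝒜 a.2 h) _ (by
        convert SetLike.mul_mem_graded a.2 (DirectSum.decompose 𝒜 x (n - i)).2 using 2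
        omega), fraction_mul hg a.2 (DirectSum.decompose 𝒜 x (n - i)).2 (by omega)]
      exact Ideal.mul_mem_left _ _ (hx _)
    · rw [fraction_congr hg (DirectSum.coe_decompose_mul_of_left_mem_of_not_le 𝒜 a.2 h) _
        (zero_mem _), fraction_zero]
      exact zero_mem _
  | add a b ha hb =>
    rw [fraction_congr hg
      (y := (DirectSum.decompose 𝒜 (a * x) n : A) + DirectSum.decompose 𝒜 (b * x) n)
      (by simp [add_mul]) _ (add_mem (Subtype.prop _) (Subtype.prop _)),
      fraction_add _ (Subtype.prop _) (Subtype.prop _)]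
    exact add_mem ha hb

/-- The ideal of the elements such that, for the component `x` of every degree `n`, all functions
`x / f c ^ n` on the open sets `f c ≠ 0` lie in the ideal sheaf `K`. -/
def vanishingIdeal : Ideal A where
  carrier := {x | ∀ c n, fraction (hf c) (DirectSum.decompose 𝒜 x n).2 ∈
    K.ideal (affineBasicOpen (hf c))}
  zero_mem' c n := by
    rw [fraction_congr (hf c) (y := 0) (by simp) _ (zero_mem _), fraction_zero]
    exact zero_mem _
  add_mem' {x y} hx hy c n := by
    rw [fraction_congr (hf c) (y := (DirectSum.decompose 𝒜 x n : A) + DirectSum.decompose 𝒜 y n)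
      (by simp) _ (add_mem (Subtype.prop _) (Subtype.prop _)),
      fraction_add _ (Subtype.prop _) (Subtype.prop _)]
    exact add_mem (hx c n) (hy c n)
  smul_mem' a x hx c n := fraction_decompose_mul_mem K (hf c) a x (hx c) n

lemma mem_vanishingIdeal {n : ℕ} {x : A} (hx : x ∈ 𝒜 n) :
    x ∈ vanishingIdeal hf K ↔ ∀ c, fraction (hf c) hx ∈ K.ideal (affineBasicOpen (hf c)) := by
  refine ⟨fun h c ↦ ?_, fun h c m ↦ ?_⟩
  · rw [fraction_congr (hf c) (DirectSum.decompose_of_mem_same 𝒜 hx).symm _ (Subtype.prop _)]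
    exact h c n
  · by_cases e : n = m
    · subst e
      rw [fraction_congr (hf c) (DirectSum.decompose_of_mem_same 𝒜 hx) _ hx]
      exact h c
    · rw [fraction_congr (hf c) (DirectSum.decompose_of_mem_ne 𝒜 hx e) _ (zero_mem _),
        fraction_zero]
      exact zero_mem _

/-- `vanishingIdeal hf K` as a homogeneous ideal. -/
def homogeneousVanishingIdeal : HomogeneousIdeal 𝒜 where
  toSubmodule := vanishingIdeal hf K
  is_homogeneous' i _ hx := (mem_vanishingIdeal hf K (Subtype.prop _)).mpr fun c ↦ hx c i

lemma mem_homogeneousVanishingIdeal {n : ℕ} {x : A} (hx : x ∈ 𝒜 n) :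
    x ∈ homogeneousVanishingIdeal hf K ↔
      ∀ c, fraction (hf c) hx ∈ K.ideal (affineBasicOpen (hf c)) :=
  mem_vanishingIdeal hf K hx

lemma fraction_pow_mul {f : A} (hf : f ∈ 𝒜 1) {m n l : ℕ} {x : A} (hx : x ∈ 𝒜 n)
    (e : m + n = l) (h : f ^ m * x ∈ 𝒜 l) : fraction hf h = fraction hf hx := by
  rw [fraction_mul hf (pow_mem_degree hf m) hx e, fraction_pow_self, one_mul]

/-- A homogeneous element whose quotient by a power of `f c` lies in the ideal sheaf lies in the
homogeneous ideal of that sheaf after multiplication by some power of `f c`. -/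
lemma exists_pow_mul_mem_vanishingIdeal [Finite C] (c : C) {n : ℕ} {x : A} (hx : x ∈ 𝒜 n)
    (h : fraction (hf c) hx ∈ K.ideal (affineBasicOpen (hf c))) :
    ∃ m, f c ^ m * x ∈ homogeneousVanishingIdeal hf K := by
  have key (d : C) : ∃ m, fraction (hf d) (SetLike.mul_mem_graded (pow_mem_degree (hf c) m) hx) ∈
      K.ideal (affineBasicOpen (hf d)) := by
    obtain ⟨t, ht⟩ : ∃ t, fraction (hf d) (hf c) = t := ⟨_, rfl⟩
    have hV : (Proj 𝒜).basicOpen t ≤ Proj.basicOpen 𝒜 (f c) :=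
      ht ▸ basicOpen_fraction_le (hf d) (hf c)
    -- On the open subset `t ≠ 0` of `f d ≠ 0`, where `t = f c / f d`, the function `x / f d ^ n` is
    -- the product of `x / f c ^ n` and `t ^ n`.
    have h1 := K.ideal_le_comap_ideal
      (U := (Proj 𝒜).affineBasicOpen (U := affineBasicOpen (hf d)) t)
      (V := affineBasicOpen (hf c)) hV h
    obtain ⟨m, hm⟩ := exists_pow_mul_mem K (affineBasicOpen (hf d)) t (fraction (hf d) hx) (by
      have := fraction_res (hf d) (hf c) hx ((Proj 𝒜).basicOpen_le t) hV
      refine Eq.mpr (congrArg (· ∈ _) this) ?_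
      rw [mul_comm]
      exact Ideal.mul_mem_left _ _ h1)
    refine ⟨m, ?_⟩
    rw [fraction_mul (hf d) (pow_mem_degree (hf c) m) hx rfl, fraction_pow (hf d) (hf c), ht]
    exact hm
  choose m hm using key
  have := Fintype.ofFinite C
  refine ⟨∑ d, m d, (mem_homogeneousVanishingIdeal hf K
    (SetLike.mul_mem_graded (pow_mem_degree (hf c) _) hx)).mpr fun d ↦ ?_⟩
  obtain ⟨r, hr⟩ := Nat.exists_eq_add_of_le'
    (Finset.single_le_sum (fun _ _ ↦ Nat.zero_le _) (Finset.mem_univ d) : m d ≤ ∑ d, m d)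
  rw [fraction_congr (hf d) (y := f c ^ r * (f c ^ m d * x)) (by rw [hr, pow_add, mul_assoc]) _ (by
    rw [← mul_assoc, ← pow_add, ← hr]
    exact SetLike.mul_mem_graded (pow_mem_degree (hf c) _) hx),
    fraction_mul (hf d) (pow_mem_degree (hf c) r)
      (SetLike.mul_mem_graded (pow_mem_degree (hf c) (m d)) hx) (by rw [hr, add_assoc])]
  exact Ideal.mul_mem_left _ _ (hm d)

lemma isSaturated_homogeneousVanishingIdeal : IsSaturated (homogeneousVanishingIdeal hf K) := by
  rintro x ⟨N, hN⟩ c n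
  have h := hN (f c ^ N) (Ideal.pow_mem_pow
    (HomogeneousIdeal.mem_irrelevant_of_mem 𝒜 one_pos (hf c)) N) c (N + n)
  rw [fraction_congr (hf c) (y := f c ^ N * DirectSum.decompose 𝒜 x n) (by
      rw [mul_comm, DirectSum.coe_decompose_mul_of_left_mem_of_le 𝒜 (pow_mem_degree (hf c) N)
        (Nat.le_add_right _ _), Nat.add_sub_cancel_left]) _
      (SetLike.mul_mem_graded (pow_mem_degree (hf c) N) (Subtype.prop _)),
    fraction_pow_mul (hf c) (Subtype.prop _) rfl] at h
  exact h

end Ideal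
end

/-! ### Closed subschemes of `Proj` and saturated ideals -/

section
variable {k : Type u} [Field k] {A : Type u} [CommRing A] [Algebra k A]
  {𝒜 : ℕ → Submodule k A} [GradedAlgebra 𝒜]

lemma fraction_eq_zero_iff {f : A} (hf : f ∈ 𝒜 1) {n : ℕ} {x : A} (hx : x ∈ 𝒜 n) :
    fraction hf hx = 0 ↔ ∃ m, f ^ m * x = 0 := by
  rw [fraction, ← map_zero (Proj.awayToSection 𝒜 f).hom]
  refine (awayToSection_bijective hf one_pos).1.eq_iff.trans ?_
  rw [HomogeneousLocalization.ext_iff_val, Away.val_mk, val_zero, Localization.mk_eq_mk',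
    IsLocalization.mk'_eq_zero_iff]
  simp [Submonoid.mem_powers_iff]

section Quotient
variable (I : HomogeneousIdeal 𝒜)

lemma mk_mem_quotientPiece {n : ℕ} {x : A} (hx : x ∈ 𝒜 n) :
    Ideal.Quotient.mk I.toIdeal x ∈ quotientPiece I n := ⟨x, hx, rfl⟩

lemma projQuotientι_app {f : A} (hf : f ∈ 𝒜 1) {n : ℕ} {x : A} (hx : x ∈ 𝒜 n) :
    (projQuotientι I).app (Proj.basicOpen 𝒜 f) (fraction hf hx) =
      fraction (mk_mem_quotientPiece I hf) (mk_mem_quotientPiece I hx) := by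
  have e : Away.map (quotientHom I) f (Away.mk 𝒜 hf n x (by simpa using hx)) =
      Away.mk (quotientPiece I) (mk_mem_quotientPiece I hf) n (Ideal.Quotient.mk I.toIdeal x)
        (by simpa using mk_mem_quotientPiece I hx) := Away.map_mk _ _ _ _ _ _
  have h := ConcreteCategory.congr_hom (Proj.awayToSection_comp_appLE (quotientHom I)
    (irrelevant_le_map _ fun _ _ _ ⟨x, hx, h⟩ ↦ ⟨x, hx, h⟩) hf)
    (Away.mk 𝒜 hf n x (by simpa using hx))
  rw [Scheme.Hom.app_eq_appLE]
  exact h.trans (congrArg (Proj.awayToSection (quotientPiece I) (quotientHom I f)).hom e)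

lemma projQuotientι_app_surjective {f : A} (hf : f ∈ 𝒜 1) :
    Function.Surjective ((projQuotientι I).app (Proj.basicOpen 𝒜 f)) := by
  intro s
  obtain ⟨n, _, ⟨x, hx, rfl⟩, rfl⟩ := exists_eq_fraction (mk_mem_quotientPiece I hf) s
  exact ⟨fraction hf hx, projQuotientι_app I hf hx⟩

lemma isAffine_preimage_projQuotientι {f : A} (hf : f ∈ 𝒜 1) :
    IsAffineOpen (projQuotientι I ⁻¹ᵁ Proj.basicOpen 𝒜 f) :=
  Proj.isAffineOpen_basicOpen (quotientPiece I) _ (mk_mem_quotientPiece I hf) one_pos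

lemma isClosedImmersion_restrict {X Y : Scheme.{u}} (h : X ⟶ Y) {U : Y.Opens} (hU : IsAffineOpen U)
    (hU' : IsAffineOpen (h ⁻¹ᵁ U)) (hs : Function.Surjective (h.app U)) :
    IsClosedImmersion (h ∣_ U) := by
  have : IsAffine U := hU
  have : IsAffine (h ⁻¹ᵁ U) := hU'
  refine IsClosedImmersion.of_surjective_of_isAffine _ ?_
  have key (V : Y.Opens) (e : V = U) : Function.Surjective (h.app V) := by
    subst e; exact hs
  rw [morphismRestrict_appTop]
  refine Function.Surjective.comp (g := X.presheaf.map
    (eqToHom (image_morphismRestrict_preimage h U ⊤)).op) ?_ (key _ U.ι_image_top)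
  exact (ConcreteCategory.bijective_of_isIso _).2

variable {C : Type*} {f : C → A} (hf : ∀ c, f c ∈ 𝒜 1)
  (hspan : (HomogeneousIdeal.irrelevant 𝒜).toIdeal ≤ Ideal.span (Set.range f))

include hf hspan in
lemma isClosedImmersion_projQuotientι : IsClosedImmersion (projQuotientι I) := by
  rw [IsZariskiLocalAtTarget.iff_of_iSup_eq_top (P := @IsClosedImmersion) _
    (Proj.iSup_basicOpen_eq_top 𝒜 f hspan)]
  exact fun c ↦ isClosedImmersion_restrict _ (Proj.isAffineOpen_basicOpen 𝒜 _ (hf c) one_pos)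
    (isAffine_preimage_projQuotientι I (hf c)) (projQuotientι_app_surjective I (hf c))

lemma fraction_mem_ker_projQuotientι [QuasiCompact (projQuotientι I)] {f : A} (hf : f ∈ 𝒜 1)
    {n : ℕ} {x : A} (hx : x ∈ 𝒜 n) :
    fraction hf hx ∈ (projQuotientι I).ker.ideal (affineBasicOpen hf) ↔ ∃ m, f ^ m * x ∈ I := by
  rw [Scheme.Hom.ker_apply, RingHom.mem_ker]
  refine (Eq.congr_left (projQuotientι_app I hf hx)).trans ?_
  refine (fraction_eq_zero_iff (mk_mem_quotientPiece I hf) (mk_mem_quotientPiece I hx)).trans ?_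
  refine exists_congr fun m ↦ ?_
  rw [← map_pow, ← map_mul, Ideal.Quotient.eq_zero_iff_mem]
  rfl

include hspan in
/-- The closed subscheme with ideal sheaf `K` is cut out by the vanishing ideal of `K`. -/
lemma ker_projQuotientι_homogeneousVanishingIdeal [Finite C] (K : (Proj 𝒜).IdealSheafData) :
    (projQuotientι (homogeneousVanishingIdeal hf K)).ker = K := by
  have := isClosedImmersion_projQuotientι (homogeneousVanishingIdeal hf K) hf hspan
  refine Scheme.IdealSheafData.ext_of_iSup_eq_top (fun c ↦ affineBasicOpen (hf c))
    (Proj.iSup_basicOpen_eq_top 𝒜 f hspan) fun c ↦ ?_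
  ext s
  obtain ⟨n, x, hx, rfl⟩ := exists_eq_fraction (hf c) s
  rw [fraction_mem_ker_projQuotientι]
  refine ⟨fun ⟨m, hm⟩ ↦ ?_, exists_pow_mul_mem_vanishingIdeal hf K c hx⟩
  rw [mem_homogeneousVanishingIdeal hf K
    (SetLike.mul_mem_graded (pow_mem_degree (hf c) m) hx)] at hm
  have := hm c
  rwa [fraction_pow_mul (hf c) hx rfl] at this

include hspan in
/-- An element multiplied into a saturated ideal by a power of each of finitely many generators of
an ideal containing the irrelevant ideal lies in the saturated ideal. -/
lemma le_of_isSaturated [Finite C] {I J : HomogeneousIdeal 𝒜} (hJ : IsSaturated J)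
    (h : ∀ c n, ∀ x ∈ 𝒜 n, x ∈ I → ∃ m, f c ^ m * x ∈ J) : I ≤ J := by
  classical
  intro x hx
  rw [← DirectSum.sum_support_decompose 𝒜 x]
  refine sum_mem fun n _ ↦ hJ _ ?_
  obtain ⟨y, hy⟩ : ∃ y, y = (DirectSum.decompose 𝒜 x n : A) := ⟨_, rfl⟩
  have hyI : y ∈ I := hy ▸ I.isHomogeneous n hx
  have hyn : y ∈ 𝒜 n := hy ▸ Subtype.prop _
  rw [← hy]
  -- The colon ideal `(J : y)`.
  let L : Ideal A := Submodule.comap (LinearMap.mulLeft A y) J.toIdeal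
  have hL : Ideal.span (Set.range f) ≤ L.radical := by
    rw [Ideal.span_le]
    rintro _ ⟨c, rfl⟩
    obtain ⟨m, hm⟩ := h c n y hyn hyI
    exact ⟨m, show y * f c ^ m ∈ J by rwa [mul_comm]⟩
  obtain ⟨N, hN⟩ := Ideal.exists_pow_le_of_le_radical_of_fg hL
    (Submodule.fg_span (Set.finite_range f))
  exact ⟨N, fun z hz ↦ hN (Ideal.pow_right_mono hspan N hz)⟩

include hf hspan in
/-- A saturated homogeneous ideal is determined by the closed subscheme that it cuts out. -/
lemma eq_of_ker_projQuotientι_eq [Finite C] {I J : HomogeneousIdeal 𝒜} (hI : IsSaturated I)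
    (hJ : IsSaturated J) (h : (projQuotientι I).ker = (projQuotientι J).ker) : I = J := by
  have := isClosedImmersion_projQuotientι I hf hspan
  have := isClosedImmersion_projQuotientι J hf hspan
  refine le_antisymm (le_of_isSaturated hspan hJ fun c n x hx hxI ↦ ?_)
    (le_of_isSaturated hspan hI fun c n x hx hxJ ↦ ?_)
  · rw [← fraction_mem_ker_projQuotientι J (hf c) hx, ← h, fraction_mem_ker_projQuotientι]
    exact ⟨0, by simpa using hxI⟩
  · rw [← fraction_mem_ker_projQuotientι I (hf c) hx, h, fraction_mem_ker_projQuotientι]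
    exact ⟨0, by simpa using hxJ⟩

include hf hspan in
/-- Closed subschemes of `Proj 𝒜` correspond to saturated homogeneous ideals, if the irrelevant
ideal is generated by finitely many elements of degree one. -/
lemma existsUnique_isSaturated [Finite C] {X : Scheme.{u}} (h : X ⟶ Proj 𝒜) [IsClosedImmersion h] :
    ∃! I : HomogeneousIdeal 𝒜, IsSaturated I ∧
      ∃ φ : X ≅ Proj (quotientPiece I), φ.hom ≫ projQuotientι I = h := by
  refine existsUnique_of_exists_of_unique ?_ ?_
  · refine ⟨homogeneousVanishingIdeal hf h.ker, isSaturated_homogeneousVanishingIdeal hf _, ?_⟩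
    have := isClosedImmersion_projQuotientι (homogeneousVanishingIdeal hf h.ker) hf hspan
    have e := ker_projQuotientι_homogeneousVanishingIdeal hf hspan h.ker
    have := IsClosedImmersion.isIso_lift _ _ e
    exact ⟨asIso (IsClosedImmersion.lift _ _ e.le), IsClosedImmersion.lift_fac _ _ _⟩
  · rintro I J ⟨hI, φ, hφ⟩ ⟨hJ, ψ, hψ⟩
    refine eq_of_ker_projQuotientι_eq hf hspan hI hJ ?_
    rw [← Scheme.Hom.ker_comp_of_isIso φ.hom, hφ, ← hψ, Scheme.Hom.ker_comp_of_isIso]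

end Quotient
end

/-! ### Monomials of the Cartesian product of polynomial rings -/

section Monomials
variable (k : Type u) [Field k] {J : Type} (ι : J → Type)

lemma weight_multidegree [DecidableEq J] (m : (Σ j, ι j) →₀ ℕ) (j : J) :
    Finsupp.weight (multidegree ι) m j = ∑ s ∈ m.support with s.1 = j, m s := by
  rw [Finsupp.weight_apply, Finsupp.sum, Finset.sum_apply, Finset.sum_filter]
  refine Finset.sum_congr rfl fun s _ ↦ ?_
  simp [multidegree, Pi.single_apply, eq_comm]

variable [Fintype J]

/-- A monomial of multidegree `(d, …, d)` with `d > 0` is divisible by a product of variables, one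
from each of the families. -/
lemma exists_eq_mul_boxMonomial {d : ℕ} (hd : 0 < d) (m : (Σ j, ι j) →₀ ℕ)
    (hm : Finsupp.weight (multidegree ι) m = fun _ ↦ d) (a : k) :
    ∃ (c : ∀ j, ι j) (m' : (Σ j, ι j) →₀ ℕ), Finsupp.weight (multidegree ι) m' = (fun _ ↦ d - 1) ∧
      (monomial m a : MvPolynomial (Σ j, ι j) k) = monomial m' a * ∏ j, X ⟨j, c j⟩ := by
  classical
  have hc (j : J) : ∃ b, m ⟨j, b⟩ ≠ 0 := by
    by_contra! h
    have h' := congrFun hm j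
    rw [weight_multidegree, Finset.sum_eq_zero] at h'
    · exact hd.ne h'
    · rintro ⟨i, b⟩ hs
      obtain rfl : i = j := (Finset.mem_filter.mp hs).2
      exact h b
  choose c hc using hc
  obtain ⟨v, hv⟩ : ∃ v : (Σ j, ι j) →₀ ℕ, v = ∑ j, Finsupp.single ⟨j, c j⟩ 1 := ⟨_, rfl⟩
  have hX : ∏ j, (X ⟨j, c j⟩ : MvPolynomial (Σ j, ι j) k) = monomial v 1 := by
    rw [hv, monomial_sum_one]
    rfl
  have hw : Finsupp.weight (multidegree ι) v = fun _ ↦ 1 := by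
    have := monomial_mem k c
    rw [hX] at this
    exact this (by simp)
  have hle : v ≤ m := by
    rintro ⟨j, b⟩
    have : v ⟨j, b⟩ = if c j = b then 1 else 0 := by
      rw [hv, Finsupp.finsetSum_apply, Finset.sum_eq_single j]
      · simp [Finsupp.single_apply]
      · intro i _ hi
        rw [Finsupp.single_apply, if_neg]
        simp [hi]
      · simp
    rw [this]
    split_ifs with h
    · subst h
      exact Nat.one_le_iff_ne_zero.mpr (hc j)
    · exact Nat.zero_le _
  refine ⟨c, m - v, ?_, ?_⟩
  · have h := congrArg (Finsupp.weight (multidegree ι)) (tsub_add_cancel_of_le hle)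
    rw [map_add, hw, hm] at h
    funext j
    have := congrFun h j
    simp only [Pi.add_apply] at this
    omega
  · rw [hX, monomial_mul, mul_one, tsub_add_cancel_of_le hle]

lemma finite_cartesianPiece [∀ j, Finite (ι j)] (d : ℕ) :
    Module.Finite k (cartesianPiece k ι d) := by
  have h : Module.Finite k (diagonalPiece k ι d) := by
    classical
    have := Fintype.ofFinite (Σ j, ι j)
    refine finite_weightedHomogeneousSubmodule _ _ ((Set.finite_Iic
      (Finsupp.equivFunOnFinite.symm fun _ : Σ j, ι j ↦ d)).subset fun m hm s ↦ ?_)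
    have h' := congrFun hm s.1
    rw [weight_multidegree] at h'
    refine le_of_le_of_eq ?_ h'
    by_cases hs : m s = 0
    · simp [hs]
    · exact Finset.single_le_sum (f := m) (fun _ _ ↦ Nat.zero_le _) (by simp [hs])
  exact Module.Finite.of_injective
    ((Cartesian k ι).val.toLinearMap.restrict (p := cartesianPiece k ι d) (q := diagonalPiece k ι d)
      fun _ hx ↦ hx) fun x y e ↦ Subtype.ext (Subtype.ext (congrArg (fun z ↦ z.1) e))

variable [Nonempty J]

/-- The irrelevant ideal of the Cartesian product is generated by the products of variables, one
from each of the families. -/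
lemma irrelevant_le_span_boxMonomial :
    (HomogeneousIdeal.irrelevant (cartesianPiece k ι)).toIdeal ≤
      Ideal.span (Set.range (boxMonomial (k := k) (ι := ι))) := by
  classical
  rw [HomogeneousIdeal.toIdeal_irrelevant_le]
  intro d hd x hx
  -- The monomials of `x` have multidegree `(d, …, d)`, so they lie in the Cartesian product.
  have hw (m : (Σ j, ι j) →₀ ℕ) (hm : m ∈ x.1.support) :
      Finsupp.weight (multidegree ι) m = fun _ ↦ d := hx (mem_support_iff.mp hm)
  have hmem (d : ℕ) (m : (Σ j, ι j) →₀ ℕ) (hm : Finsupp.weight (multidegree ι) m = fun _ ↦ d)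
      (a : k) : monomial m a ∈ Cartesian k ι :=
    diagonalPiece_le k ι d ⟨_, isWeightedHomogeneous_monomial _ _ _ hm⟩
  have hsum : x = ∑ m : x.1.support, (⟨monomial m.1 (coeff m.1 x.1), hmem d m (hw m m.2) _⟩ :
      Cartesian k ι) := by
    refine Subtype.ext ?_
    rw [AddSubmonoidClass.coe_finsetSum]
    exact (support_sum_monomial_coeff x.1).symm.trans (Finset.sum_coe_sort x.1.support
      fun m ↦ monomial m (coeff m x.1)).symm
  rw [hsum]
  refine sum_mem fun m _ ↦ ?_
  obtain ⟨c, m', hm', e⟩ := exists_eq_mul_boxMonomial k ι hd m (hw m m.2) (coeff m.1 x.1)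
  have : (⟨monomial m.1 (coeff m.1 x.1), hmem d m (hw m m.2) _⟩ : Cartesian k ι) =
      ⟨monomial m' (coeff m.1 x.1), hmem (d - 1) m' hm' _⟩ * boxMonomial c := Subtype.ext e
  rw [this]
  exact Ideal.mul_mem_left _ _ (Ideal.subset_span ⟨c, rfl⟩)

variable {k ι} in
/-- Closed subschemes of `Proj` of the Cartesian product correspond to saturated homogeneous
ideals. -/
lemma existsUnique_isSaturated_cartesian [∀ j, Finite (ι j)] {X : Scheme.{u}}
    (h : X ⟶ Proj (cartesianPiece k ι)) (hh : IsClosedImmersion h) :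
    ∃! I : HomogeneousIdeal (cartesianPiece k ι), IsSaturated I ∧
      ∃ φ : X ≅ Proj (quotientPiece I), φ.hom ≫ projQuotientι I = h :=
  existsUnique_isSaturated (𝒜 := cartesianPiece k ι) (f := boxMonomial) (boxMonomial_mem k)
    (irrelevant_le_span_boxMonomial k ι) h

end Monomials

/-- Over a field, the localization at `f = 1` already gives a free module. -/
lemma isLocallyFreeOfRank_finrank (k : Type u) [Field k] (M : Type w) [AddCommGroup M] [Module k M]
    [Module.Finite k M] : IsLocallyFreeOfRank k M (Module.finrank k M) := by
  refine ⟨{1}, by simp, fun f _ ↦ ⟨?_⟩⟩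
  exact Module.Basis.ofIsLocalizedModule (Localization.Away f) (.powers f)
    (LocalizedModule.mkLinearMap (.powers f) M) (Module.finBasis k M)

end LL

end

theorem mainTheorem3 {k : Type u} [Field k] {V : Type v} (ζ : ProofNet V) :
    IsClosedImmersion (ζ.inclusion k ≫ ζ.toConclusionSpace k).left ∧
    (∃! I : HomogeneousIdeal (ζ.coordinatePiece k), IsSaturated I ∧ ζ.CutsOut k I) ∧
    ∀ I : HomogeneousIdeal (ζ.coordinatePiece k), IsSaturated I → ζ.CutsOut k I →
      ∀ d : ℕ, ∃ r : ℕ, IsLocallyFreeOfRank k (quotientPiece I d) r := by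
  have h1 : IsClosedImmersion (ζ.inclusion k ≫ ζ.toConclusionSpace k).left :=
    isClosedImmersion_conclusions ζ
  have h2 := isClosedImmersion_prodToProj k fun j : ζ.Conclusion ↦ (ζ.lab j.1).Coord
  refine ⟨h1, ?_, fun I _ _ d ↦ ?_⟩
  · have h3 := @IsClosedImmersion.comp _ _ _ _ _ h1 h2
    exact existsUnique_isSaturated_cartesian _ h3
  · have := finite_cartesianPiece k (fun j : ζ.Conclusion ↦ (ζ.lab j.1).Coord) d
    have : Module.Finite k (quotientPiece I d) := Module.Finite.map _ _
    exact ⟨_, isLocallyFreeOfRank_finrank k _⟩
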